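/- Let $\pm[n]=\{-n,\dots,-1,1,\dots,n\}$ index the facets of the $n$-dimensional cube, opposite facets being $i$ and $-i$, and let $\Delta_n$ be the dual simplicial complex of the cube, i.e. the set of all $A\subseteq\pm[n]$ containing no pair $\{i,-i\}$. A hypercube graph is a graph on $\pm[n]$ whose edges belong to $\Delta_n$. A tube of such a graph is a nonempty $t\in\Delta_n$ inducing a connected subgraph; a tubing is a set of tubes whose union belongs to $\Delta_n$ and any two of which are either nested or disjoint with no edge between them. The tubings form a simplicial complex on the set of tubes. A hypercube-graph associahedron of the graph is an $n$-dimensional simple polyhedron in $\mathbb{R}^n$ whose dual simplicial complex (the sets of facets with nonempty common intersection) is isomorphic to the complex of tubings. Let the twisted cycle graph $TC_n$ be the hypercube graph on $\pm[n]$ given by the cycle $(1,\dots,n,-1,\dots,-n)$ (for $n=1$ the pair $\{1,-1\}\notin\Delta_1$ is not an edge, so $TC_1$ has no edges). 1. For every family $(P_n)_{n\ge 0}$ such that $P_n$ is a hypercube-graph associahedron of $TC_n$, if $f_k^{P_n}$ denotes the number of $k$-dimensional (nonempty) faces of $P_n$, then, as formal power series, $$f^{TC}(x,y)=\sum_{n,k\ge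 0} f_k^{P_n}\,x^k y^n=\frac{(1-xy)-2y}{(1-xy)^2-4y}.$$ 2. Equivalently, if $g_{n,k}$ denotes the number of tubings of $TC_n$ consisting of exactly $k$ tubes (the empty tubing included), then $$f^{\Delta(TC)}(s,t)=\sum_{n,k\ge 0} g_{n,k}\,s^k t^n=\frac{(1-t)-2st}{(1-t)^2-4st}.$$ 3. Consequently, for every $n\ge 1$ the number of inclusion-maximal tubings of $TC_n$ is $2^{2n-1}$. -/

import Mathlib

noncomputable section

/-! ### Simplicial complexes and graphs on them -/

/-- A simplicial complex on the base set `S`, in the convention in which the empty set is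
always a face and is counted by the `f`-vector. -/
structure FaceComplex (S : Type*) where
  faces : Set (Finset S)
  empty_mem : ∅ ∈ faces
  singleton_mem : ∀ s : S, {s} ∈ faces
  down_closed : ∀ ⦃A B : Finset S⦄, A ∈ faces → B ⊆ A → B ∈ faces

/-- `f_k` of a simplicial complex: the number of faces with exactly `k` elements. -/
def FaceComplex.fVector {S : Type*} (Δ : FaceComplex S) (k : ℕ) : ℕ :=
  {A : Finset S | A ∈ Δ.faces ∧ A.card = k}.ncard

/-- Two simplicial complexes are isomorphic if a bijection of the base sets identifies faces. -/
def FaceComplex.Isomorphic {S T : Type*} (Δ : FaceComplex S) (Γ : FaceComplex T) : Prop :=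
  ∃ e : S ≃ T, ∀ A : Finset S, A ∈ Δ.faces ↔ A.map e.toEmbedding ∈ Γ.faces

/-- A `Δ`-graph: a graph on the base set of `Δ`, all of whose edges are faces of `Δ`. -/
structure DeltaGraph {S : Type*} [DecidableEq S] (Δ : FaceComplex S) where
  graph : SimpleGraph S
  edge_mem : ∀ a b : S, graph.Adj a b → {a, b} ∈ Δ.faces

namespace DeltaGraph

variable {S : Type*} [DecidableEq S] {Δ : FaceComplex S}

/-- A tube: a face of `Δ` inducing a connected (in particular nonempty) subgraph. -/
def IsTube (G : DeltaGraph Δ) (t : Finset S) : Prop :=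
  t ∈ Δ.faces ∧ (G.graph.induce (t : Set S)).Connected

/-- Weak compatibility: nested, or disjoint with no edge in between. -/
def WeaklyCompatible (G : DeltaGraph Δ) (t u : Finset S) : Prop :=
  t ⊆ u ∨ u ⊆ t ∨ (Disjoint t u ∧ ∀ a ∈ t, ∀ b ∈ u, ¬ G.graph.Adj a b)

/-- A tubing: a set of pairwise weakly compatible tubes whose union is a face of `Δ`. -/
def IsTubing (G : DeltaGraph Δ) (T : Finset {t : Finset S // G.IsTube t}) : Prop :=
  (∀ t ∈ T, ∀ u ∈ T, G.WeaklyCompatible t.1 u.1) ∧ T.biUnion Subtype.val ∈ Δ.faces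

/-- The simplicial complex of tubings, on the set of tubes. -/
def tubingComplex (G : DeltaGraph Δ) : FaceComplex {t : Finset S // G.IsTube t} where
  faces := {T | G.IsTubing T}
  empty_mem := ⟨by simp, by simpa using Δ.empty_mem⟩
  singleton_mem := fun t => ⟨by
    intro a ha b hb
    rw [Finset.mem_singleton] at ha hb
    subst ha hb
    exact Or.inl (Finset.Subset.refl _), by simpa using t.2.1⟩
  down_closed := fun A B hA hBA =>
    ⟨fun t ht u hu => hA.1 t (hBA ht) u (hBA hu),
      Δ.down_closed hA.2 (Finset.biUnion_subset_biUnion_of_subset_left _ hBA)⟩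

/-- A tubing is maximal if it is not properly contained in another tubing. -/
def IsMaximalTubing (G : DeltaGraph Δ) (T : Finset {t : Finset S // G.IsTube t}) : Prop :=
  Maximal G.IsTubing T

end DeltaGraph

/-! ### Hypercube graphs and the twisted cycle -/

/-- The set `±[n] = {-n, …, -1, 1, …, n}`, indexing the facets of the `n`-dimensional cube. -/
abbrev PlusMinus (n : ℕ) : Type := {i : ℤ // i ≠ 0 ∧ |i| ≤ (n : ℤ)}

/-- The dual simplicial complex of the `n`-cube: the subsets of `±[n]` containing no pair
`{i, -i}`. -/
def hypercubeComplex (n : ℕ) : FaceComplex (PlusMinus n) where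
  faces := {A | ∀ a ∈ A, ∀ b ∈ A, (b : ℤ) ≠ -(a : ℤ)}
  empty_mem := by simp
  singleton_mem := fun s => by
    intro a ha b hb
    rw [Finset.mem_singleton] at ha hb
    subst ha hb
    have := b.2.1
    omega
  down_closed := fun A B hA hBA a ha b hb => hA a (hBA ha) b (hBA hb)

/-- `b` comes right after `a` in the cyclic order `1, …, n, -1, …, -n`. -/
def TwistedCycleSucc (n : ℕ) (a b : ℤ) : Prop :=
  (0 < a ∧ b = a + 1) ∨ (a < 0 ∧ b = a - 1) ∨
    (a = (n : ℤ) ∧ b = -1) ∨ (a = -(n : ℤ) ∧ b = 1)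

/-- The twisted cycle graph: the hypercube graph on `±[n]` which is the cycle
`(1, …, n, -1, …, -n)`. The condition `b ≠ -a` only matters for `n = 1`, where the pair `{1, -1}`
is not a face of the hypercube complex and so cannot be an edge. -/
def twistedCycle (n : ℕ) : DeltaGraph (hypercubeComplex n) where
  graph := SimpleGraph.fromRel fun a b : PlusMinus n =>
    TwistedCycleSucc n (a : ℤ) (b : ℤ) ∧ (b : ℤ) ≠ -(a : ℤ)
  edge_mem := fun a b hab => by
    have h1 := a.2.1
    have h2 := b.2.1
    have h3 : (b : ℤ) ≠ -(a : ℤ) := by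
      rw [SimpleGraph.fromRel_adj] at hab
      rcases hab.2 with h | h
      · exact h.2
      · have := h.2
        omega
    intro x hx y hy
    rw [Finset.mem_insert, Finset.mem_singleton] at hx hy
    rcases hx with rfl | rfl <;> rcases hy with rfl | rfl <;> omega

/-! ### Simple polyhedra -/

/-- A polyhedron in `ℝⁿ`: the solution set of finitely many non-strict linear inequalities. -/
def IsPolyhedron {n : ℕ} (P : Set (Fin n → ℝ)) : Prop :=
  ∃ (m : ℕ) (c : Fin m → Fin n → ℝ) (b : Fin m → ℝ), P = {x | ∀ i, b i ≤ c i ⬝ᵥ x}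

/-- The nonempty faces of a polyhedron: the nonempty sets of maximizers of linear functionals.
The polyhedron itself is one of them. -/
def IsNonemptyFace {n : ℕ} (P F : Set (Fin n → ℝ)) : Prop :=
  F.Nonempty ∧ IsExposed ℝ P F

/-- The dimension of (the affine hull of) a nonempty set. -/
def affDim {n : ℕ} (F : Set (Fin n → ℝ)) : ℕ :=
  Module.finrank ℝ (vectorSpan ℝ F)

/-- The facets of an `n`-dimensional polyhedron in `ℝⁿ`: its faces of dimension `n - 1`. -/
def IsFacet {n : ℕ} (P F : Set (Fin n → ℝ)) : Prop :=
  IsNonemptyFace P F ∧ affDim F + 1 = n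

/-- A full-dimensional simple polyhedron in `ℝⁿ`: every nonempty face of codimension `k` is
contained in exactly `k` facets. -/
structure SimplePolyhedron (n : ℕ) where
  carrier : Set (Fin n → ℝ)
  isPolyhedron : IsPolyhedron carrier
  nonempty : carrier.Nonempty
  full_dim : affDim carrier = n
  simple : ∀ F, IsNonemptyFace carrier F →
    {H | IsFacet carrier H ∧ F ⊆ H}.ncard + affDim F = n

namespace SimplePolyhedron

/-- `f_k` of a polyhedron: the number of nonempty faces of dimension `k`. -/
def fVector {n : ℕ} (P : SimplePolyhedron n) (k : ℕ) : ℕ :=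
  {F | IsNonemptyFace P.carrier F ∧ affDim F = k}.ncard

/-- The dual simplicial complex of a simple polyhedron: the sets of facets with nonempty common
intersection (the intersection over the empty set of facets being the polyhedron itself). -/
def dualComplex {n : ℕ} (P : SimplePolyhedron n) :
    FaceComplex {F : Set (Fin n → ℝ) // IsFacet P.carrier F} where
  faces := {I | (P.carrier ∩ ⋂ F ∈ I, F.1).Nonempty}
  empty_mem := by simpa using P.nonempty
  singleton_mem := fun F => by
    obtain ⟨x, hx⟩ := F.2.1.1
    exact ⟨x, F.2.1.2.subset hx, by simpa using hx⟩
  down_closed := fun A B hA hBA => by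
    obtain ⟨x, hx, hxA⟩ := hA
    refine ⟨x, hx, ?_⟩
    rw [Set.mem_iInter₂] at hxA ⊢
    exact fun F hF => hxA F (hBA hF)

end SimplePolyhedron

/-- `P` is an `n`-dimensional graph associahedron of the `Δ`-graph `G`: a simple polyhedron whose
dual simplicial complex is isomorphic to the complex of tubings of `G`. -/
def IsGraphAssociahedron {S : Type*} [DecidableEq S] {Δ : FaceComplex S} {n : ℕ}
    (P : SimplePolyhedron n) (G : DeltaGraph Δ) : Prop :=
  P.dualComplex.Isomorphic G.tubingComplex

/-! ### Bivariate `f`-polynomials -/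

/-- The formal power series `∑ f n k * X₀ ^ k * X₁ ^ n` in two variables. -/
def bivariateSeries (f : ℕ → ℕ → ℕ) : MvPowerSeries (Fin 2) ℚ :=
  fun e => (f (e 1) (e 0) : ℚ)

/-- The bivariate `f`-polynomial of a family of polyhedra `P n`, with `P n` of dimension `n`. -/
def polyhedraFPolynomial (P : ∀ n : ℕ, SimplePolyhedron n) : MvPowerSeries (Fin 2) ℚ :=
  bivariateSeries fun n k => (P n).fVector k

/-- The bivariate `f`-polynomial of a family of simplicial complexes. -/
def complexesFPolynomial {S : ℕ → Type*} (Δ : ∀ n : ℕ, FaceComplex (S n)) :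
    MvPowerSeries (Fin 2) ℚ :=
  bivariateSeries fun n k => (Δ n).fVector k

end

/-!
The complex of tubings of the twisted cycle is a flag complex: a set of tubes is a tubing as soon
as its members are pairwise compatible, where compatibility includes that the union of the two
tubes is a face. Its face numbers are therefore clique numbers, with generating function
`cliqueSum`.

A tube of `TC_n` is an arc of at most `n` vertices (`CycleCoord.exists_eq_initial_arc`). The members
of a tubing that contain a fixed vertex or its antipode form a chain, so that tubings can be sorted
by the largest such member (`cliqueSum_eq_add_sum`, `cliqueSum_tubes`). If there is none, what
remains are two antipodal paths of `n - 1` vertices; if it is an arc of `m` vertices, for which there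
are `2 * m` choices, then what remains is a tubing inside of this arc and a tubing of the two
antipodal paths of `n - m` vertices that separate the arc from its antipode. The tubings of
antipodal paths are sets of signed intervals, and sorting them by the largest interval at the first
vertex gives linear recursions (`signedPathSum_succ`).

Let `b` be the generating function of the tubings of nonempty paths that contain the whole path,
with `s` marking tubes and `x` marking vertices. It satisfies
`b = x (1 + b) (s (1 + b) + b)` (`tubeSeries_eq`), and with `D = 1 - b - x - b x` the recursions give
`(1 + b) / D` for the antipodal paths without restriction and `1 / (D (1 + b))` for those between
an arc and its antipode. Hence the generating function of all tubings is
`1 + x (1 + b) / D + 2 x b' / (D (1 + b))`. The quotient `q = D / (1 + b)` satisfies `q ^ 2 = E` with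
`E = (1 - x) ^ 2 - 4 s x`, and the sum equals `1 - x q' / q = 1 - x E' / (2 E)`, which is rational
(`rational_of_tubeSeries`). In other words, the polynomial counting the tubings of `TC_n` is the
Chebyshev polynomial `T_n (1 + 2 s)` (`tubingPolynomial_add_two`).

For polyhedra, an irredundant system of inequalities is chosen. Its members correspond to the
facets, a nonempty face is cut out by the inequalities that are tight on it, and simplicity makes
the normals of these independent, so that every set of facets with nonempty common intersection is
the set of all facets through that intersection (`activeSet_tightSet`). Thus the faces of dimension
`k` correspond to the sets of `n - k` facets with nonempty common intersection.

Finally, every tube of a maximal tubing is the hull of exactly one vertex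
(`DeltaGraph.IsMaximalTubing.card_eq`), so that the maximal tubings of `TC_n` are those of `n` tubes,
whose number is the leading coefficient of `T_n (1 + 2 s)`.
-/

noncomputable section

/-! ### Faces of polyhedra given by inequalities -/

section Inequalities

variable {n : ℕ} {ι : Type*}

/-- The polyhedron cut out by the inequalities `b i ≤ c i ⬝ᵥ x`. -/
def solutionSet (c : ι → Fin n → ℝ) (b : ι → ℝ) : Set (Fin n → ℝ) :=
  {x | ∀ i, b i ≤ c i ⬝ᵥ x}

/-- The part of `solutionSet c b` on which the inequalities indexed by `J` are equalities. -/
def tightSet (c : ι → Fin n → ℝ) (b : ι → ℝ) (J : Finset ι) : Set (Fin n → ℝ) :=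
  {x | x ∈ solutionSet c b ∧ ∀ i ∈ J, c i ⬝ᵥ x = b i}

/-- The linear map whose coordinates are the normals `c i` for `i ∈ J`. -/
def normalMap (c : ι → Fin n → ℝ) (J : Finset ι) : (Fin n → ℝ) →ₗ[ℝ] (J → ℝ) :=
  Matrix.mulVecLin (Matrix.of fun i : J => c i)

variable {c : ι → Fin n → ℝ} {b : ι → ℝ}

lemma normalMap_apply (J : Finset ι) (v : Fin n → ℝ) (i : J) :
    normalMap c J v i = c i ⬝ᵥ v := rfl

lemma mem_ker_normalMap {J : Finset ι} {v : Fin n → ℝ} :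
    v ∈ LinearMap.ker (normalMap c J) ↔ ∀ i ∈ J, c i ⬝ᵥ v = 0 := by
  rw [LinearMap.mem_ker, funext_iff]
  simp [normalMap_apply]

lemma midpoint_dotProduct (u x y : Fin n → ℝ) :
    u ⬝ᵥ ((1 / 2 : ℝ) • x + (1 / 2 : ℝ) • y) = (u ⬝ᵥ x + u ⬝ᵥ y) / 2 := by
  simp only [dotProduct_add, dotProduct_smul, smul_eq_mul]
  ring

lemma convex_solutionSet : Convex ℝ (solutionSet c b) := by
  intro x hx y hy p q hp hq hpq i
  rw [dotProduct_add, dotProduct_smul, dotProduct_smul, smul_eq_mul, smul_eq_mul]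
  have h1 := mul_le_mul_of_nonneg_left (hx i) hp
  have h2 := mul_le_mul_of_nonneg_left (hy i) hq
  have h3 : p * b i + q * b i = b i := by rw [← add_mul, hpq, one_mul]
  linarith

lemma isExposed_tightSet (J : Finset ι) : IsExposed ℝ (solutionSet c b) (tightSet c b J) := by
  rintro ⟨x₀, hx₀⟩
  let l : (Fin n → ℝ) →ₗ[ℝ] ℝ := -∑ i ∈ J, dotProductBilin ℝ ℝ (c i)
  have hl : ∀ x, l x = -∑ i ∈ J, c i ⬝ᵥ x := fun x => by
    simp [l, dotProductBilin]
  refine ⟨LinearMap.toContinuousLinearMap l, ?_⟩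
  ext x
  simp only [LinearMap.coe_toContinuousLinearMap', Set.mem_ofPred_eq, hl, neg_le_neg_iff]
  constructor
  · intro hx
    refine ⟨hx.1, fun y hy => Finset.sum_le_sum fun i hi => ?_⟩
    rw [hx.2 i hi]
    exact hy i
  · rintro ⟨hx, hmax⟩
    refine ⟨hx, fun i hi => ?_⟩
    have h0 := hmax x₀ hx₀.1
    rw [Finset.sum_congr rfl hx₀.2] at h0
    exact ((Finset.sum_eq_sum_iff_of_le fun i _ => hx i).1
      (le_antisymm (Finset.sum_le_sum fun i _ => hx i) h0) i hi).symm

lemma convex_of_isExposed {F : Set (Fin n → ℝ)} (hF : IsNonemptyFace (solutionSet c b) F) :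
    Convex ℝ F :=
  hF.2.convex convex_solutionSet

lemma isNonemptyFace_tightSet {J : Finset ι} (h : (tightSet c b J).Nonempty) :
    IsNonemptyFace (solutionSet c b) (tightSet c b J) :=
  ⟨h, isExposed_tightSet J⟩

variable [Fintype ι]

/-- A convex part of a polyhedron has a point at which every inequality is strict that is
strict somewhere on this part. -/
lemma exists_generic_point {F : Set (Fin n → ℝ)} (hF : F ⊆ solutionSet c b) (hconv : Convex ℝ F)
    (hne : F.Nonempty) :
    ∃ x ∈ F, ∀ i, (∃ y ∈ F, b i < c i ⬝ᵥ y) → b i < c i ⬝ᵥ x := by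
  classical
  have key : ∀ S : Finset ι, ∃ x ∈ F, ∀ i ∈ S, (∃ y ∈ F, b i < c i ⬝ᵥ y) → b i < c i ⬝ᵥ x := by
    intro S
    induction S using Finset.induction_on with
    | empty =>
      obtain ⟨x, hx⟩ := hne
      exact ⟨x, hx, by simp⟩
    | insert j S _ ih =>
      obtain ⟨x, hx, hxS⟩ := ih
      by_cases hj : ∃ y ∈ F, b j < c j ⬝ᵥ y
      · obtain ⟨y, hy, hyj⟩ := hj
        refine ⟨(1 / 2 : ℝ) • x + (1 / 2 : ℝ) • y,
          hconv hx hy (by norm_num) (by norm_num) (by norm_num), ?_⟩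
        intro i hi hex
        rw [midpoint_dotProduct]
        have h1 := hF hx i
        have h2 := hF hy i
        rcases Finset.mem_insert.1 hi with rfl | hi
        · linarith
        · have := hxS i hi hex
          linarith
      · refine ⟨x, hx, fun i hi hex => ?_⟩
        rcases Finset.mem_insert.1 hi with rfl | hi
        · exact absurd hex hj
        · exact hxS i hi hex
  obtain ⟨x, hx, h⟩ := key Finset.univ
  exact ⟨x, hx, fun i => h i (Finset.mem_univ i)⟩

/-- A small step in a direction along which no tight inequality decreases stays in the
polyhedron. -/
lemma exists_small_step {x v : Fin n → ℝ} (hx : x ∈ solutionSet c b)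
    (hv : ∀ i, c i ⬝ᵥ x = b i → 0 ≤ c i ⬝ᵥ v) :
    ∃ ε : ℝ, 0 < ε ∧ x + ε • v ∈ solutionSet c b := by
  have hev : ∀ᶠ t : ℝ in nhds 0, ∀ i, b i < c i ⬝ᵥ x → b i < c i ⬝ᵥ (x + t • v) := by
    rw [Filter.eventually_all]
    intro i
    by_cases hi : b i < c i ⬝ᵥ x
    · have hcont : Continuous fun t : ℝ => c i ⬝ᵥ (x + t • v) := by
        simp only [dotProduct_add, dotProduct_smul]
        fun_prop
      have : ∀ᶠ t : ℝ in nhds 0, b i < c i ⬝ᵥ (x + t • v) :=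
        hcont.continuousAt.eventually (lt_mem_nhds (by simpa using hi))
      exact this.mono fun t ht _ => ht
    · exact Filter.Eventually.of_forall fun t h => absurd h hi
  obtain ⟨δ, hδ, hball⟩ := Metric.eventually_nhds_iff.1 hev
  have hlt := hball (y := δ / 2) (by rw [Real.dist_eq, sub_zero, abs_of_pos (by linarith)]; linarith)
  refine ⟨δ / 2, by linarith, fun i => ?_⟩
  rcases (hx i).lt_or_eq with h | h
  · exact (hlt i h).le
  · rw [dotProduct_add, dotProduct_smul, smul_eq_mul, ← h]
    have := mul_nonneg (by linarith : 0 ≤ δ / 2) (hv i h.symm)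
    linarith

open Classical in
/-- The indices of the inequalities that are equalities on all of `F`. -/
def activeSet (c : ι → Fin n → ℝ) (b : ι → ℝ) (F : Set (Fin n → ℝ)) : Finset ι :=
  Finset.univ.filter fun i => ∀ x ∈ F, c i ⬝ᵥ x = b i

lemma mem_activeSet {F : Set (Fin n → ℝ)} {i : ι} :
    i ∈ activeSet c b F ↔ ∀ x ∈ F, c i ⬝ᵥ x = b i := by
  simp [activeSet]

/-- Only the active inequalities of a set are tight at a generic point of it. -/
lemma mem_activeSet_of_generic {F : Set (Fin n → ℝ)} {x : Fin n → ℝ} {i : ι}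
    (hF : F ⊆ solutionSet c b) (hx : ∀ i, (∃ y ∈ F, b i < c i ⬝ᵥ y) → b i < c i ⬝ᵥ x)
    (hi : c i ⬝ᵥ x = b i) : i ∈ activeSet c b F := by
  rw [mem_activeSet]
  intro z hz
  by_contra hne
  exact (hx i ⟨z, hz, lt_of_le_of_ne (hF hz i) (Ne.symm hne)⟩).ne' hi

/-- A nonempty face is cut out by its active inequalities: prolonging the segment from a point
of the tight set to a generic point of the face stays in the polyhedron, so that the functional
maximized on the face is constant along it. -/
lemma face_eq_tightSet {F : Set (Fin n → ℝ)} (hF : IsNonemptyFace (solutionSet c b) F) :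
    F = tightSet c b (activeSet c b F) := by
  obtain ⟨x, hxF, hx⟩ := exists_generic_point hF.2.subset (convex_of_isExposed hF) hF.1
  refine Set.Subset.antisymm (fun y hy => ⟨hF.2.subset hy, fun i hi => mem_activeSet.1 hi y hy⟩) ?_
  rintro y ⟨hyP, hy⟩
  have hxP := hF.2.subset hxF
  obtain ⟨ε, hε, hmem⟩ := exists_small_step (v := x - y) hxP (fun i hi => by
    rw [dotProduct_sub, hi, hy i (mem_activeSet_of_generic hF.2.subset hx hi), sub_self])
  obtain ⟨l, hl⟩ := hF.2 hF.1
  rw [hl] at hxF ⊢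
  refine ⟨hyP, fun z hz => (hxF.2 z hz).trans ?_⟩
  have h1 := hxF.2 _ hmem
  rw [map_add, map_smul, map_sub, smul_eq_mul] at h1
  nlinarith

lemma vectorSpan_face {F : Set (Fin n → ℝ)} (hF : IsNonemptyFace (solutionSet c b) F) :
    vectorSpan ℝ F = LinearMap.ker (normalMap c (activeSet c b F)) := by
  apply le_antisymm
  · rw [vectorSpan_def, Submodule.span_le]
    rintro _ ⟨x, hx, y, hy, rfl⟩
    rw [SetLike.mem_coe, mem_ker_normalMap]
    intro i hi
    change c i ⬝ᵥ (x - y) = 0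
    rw [dotProduct_sub, mem_activeSet.1 hi x hx, mem_activeSet.1 hi y hy, sub_self]
  · intro v hv
    rw [mem_ker_normalMap] at hv
    obtain ⟨x, hxF, hx⟩ := exists_generic_point hF.2.subset (convex_of_isExposed hF) hF.1
    obtain ⟨ε, hε, hmem⟩ := exists_small_step (v := v) (hF.2.subset hxF)
      (fun i hi => (hv i (mem_activeSet_of_generic hF.2.subset hx hi)).ge)
    have hmemF : x + ε • v ∈ F := by
      rw [face_eq_tightSet hF] at hxF ⊢
      refine ⟨hmem, fun i hi => ?_⟩
      rw [dotProduct_add, dotProduct_smul, hv i hi, hxF.2 i hi, smul_zero, add_zero]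
    have h := vsub_mem_vectorSpan ℝ hmemF hxF
    rw [vsub_eq_sub, add_sub_cancel_left] at h
    exact ((vectorSpan ℝ F).smul_mem_iff hε.ne').1 h

lemma subset_activeSet_tightSet (J : Finset ι) : J ⊆ activeSet c b (tightSet c b J) :=
  fun _ hi => mem_activeSet.2 fun _ hx => hx.2 _ hi

end Inequalities

/-- Every polyhedron has a representation none of whose inequalities can be dropped. -/
lemma IsPolyhedron.exists_irredundant {n : ℕ} {P : Set (Fin n → ℝ)} (hP : IsPolyhedron P) :
    ∃ (m : ℕ) (c : Fin m → Fin n → ℝ) (b : Fin m → ℝ), P = solutionSet c b ∧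
      ∀ i, ∃ y, (∀ j, j ≠ i → b j ≤ c j ⬝ᵥ y) ∧ c i ⬝ᵥ y < b i := by
  classical
  have hex : ∃ m, ∃ (c : Fin m → Fin n → ℝ) (b : Fin m → ℝ), P = solutionSet c b := hP
  obtain ⟨c, b, hcb⟩ := Nat.find_spec hex
  have hmin := fun k hk => Nat.find_min (m := k) hex hk
  generalize Nat.find hex = m at c b hcb hmin
  refine ⟨m, c, b, hcb, fun i => ?_⟩
  by_contra! hno
  cases m with
  | zero => exact i.elim0
  | succ k =>
    refine hmin k (Nat.lt_succ_self k) ⟨fun j => c (i.succAbove j), fun j => b (i.succAbove j), ?_⟩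
    rw [hcb]
    ext x
    refine ⟨fun hx j => hx _, fun hx => ?_⟩
    have hne : ∀ j, j ≠ i → b j ≤ c j ⬝ᵥ x := by
      intro j hj
      obtain ⟨j', rfl⟩ := Fin.exists_succAbove_eq hj
      exact hx j'
    intro j
    by_cases hj : j = i
    · subst hj
      exact hno x hne
    · exact hne j hj

/-! ### Facets of simple polyhedra -/

section Irredundant

variable {n m : ℕ} {c : Fin m → Fin n → ℝ} {b : Fin m → ℝ}

/-- A system of inequalities with a full-dimensional solution set, none of which follows from
the others. -/
structure IsIrredundantSystem (c : Fin m → Fin n → ℝ) (b : Fin m → ℝ) : Prop where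
  full_dim : affDim (solutionSet c b) = n
  nonempty : (solutionSet c b).Nonempty
  irredundant : ∀ i, ∃ y, (∀ j, j ≠ i → b j ≤ c j ⬝ᵥ y) ∧ c i ⬝ᵥ y < b i

/-- An irredundant full-dimensional system has a strict solution. -/
lemma exists_strict_solution (h : IsIrredundantSystem c b) :
    ∃ z, ∀ i, b i < c i ⬝ᵥ z := by
  obtain ⟨z, hz, hstrict⟩ := exists_generic_point (Set.Subset.refl (solutionSet c b))
    convex_solutionSet h.nonempty
  refine ⟨z, fun i => hstrict i ?_⟩
  by_contra! hno
  have hspan : vectorSpan ℝ (solutionSet c b) = ⊤ :=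
    Submodule.eq_top_of_finrank_eq (by rw [Module.finrank_fin_fun]; exact h.full_dim)
  have hker : vectorSpan ℝ (solutionSet c b) ≤ LinearMap.ker (normalMap c {i}) := by
    rw [vectorSpan_def, Submodule.span_le]
    rintro _ ⟨x, hx, y, hy, rfl⟩
    rw [SetLike.mem_coe, mem_ker_normalMap]
    intro j hj
    rw [Finset.mem_singleton.1 hj]
    change c i ⬝ᵥ (x - y) = 0
    rw [dotProduct_sub, le_antisymm (hno x hx) (hx i), le_antisymm (hno y hy) (hy i), sub_self]
  have hzero : ∀ v, c i ⬝ᵥ v = 0 := fun v =>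
    mem_ker_normalMap.1 (hker (hspan ▸ Submodule.mem_top : v ∈ _)) i (Finset.mem_singleton_self i)
  obtain ⟨y, -, hy⟩ := h.irredundant i
  have h1 := hz i
  have h2 := hno z hz
  rw [hzero] at hy h1 h2
  linarith

/-- Every inequality of such a system is the only tight one at some solution: the segment from
a strict solution to a point violating only this inequality crosses its hyperplane there. -/
lemma exists_wall_point (h : IsIrredundantSystem c b) (i : Fin m) :
    ∃ w, c i ⬝ᵥ w = b i ∧ ∀ j, j ≠ i → b j < c j ⬝ᵥ w := by
  obtain ⟨z, hz⟩ := exists_strict_solution h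
  obtain ⟨y, hy, hyi⟩ := h.irredundant i
  have hzi := hz i
  have hd : 0 < c i ⬝ᵥ z - c i ⬝ᵥ y := by linarith
  obtain ⟨t, ht⟩ : ∃ t, t = (c i ⬝ᵥ z - b i) / (c i ⬝ᵥ z - c i ⬝ᵥ y) := ⟨_, rfl⟩
  have ht0 : 0 < t := ht ▸ div_pos (by linarith) hd
  have ht1 : t < 1 := ht ▸ (div_lt_one hd).2 (by linarith)
  have hcomb : ∀ j, c j ⬝ᵥ ((1 - t) • z + t • y) = (1 - t) * (c j ⬝ᵥ z) + t * (c j ⬝ᵥ y) := by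
    intro j
    simp only [dotProduct_add, dotProduct_smul, smul_eq_mul]
  refine ⟨(1 - t) • z + t • y, ?_, fun j hj => ?_⟩
  · rw [hcomb]
    have : t * (c i ⬝ᵥ z - c i ⬝ᵥ y) = c i ⬝ᵥ z - b i := by rw [ht]; field_simp
    linarith
  · rw [hcomb]
    have h1 := mul_lt_mul_of_pos_left (hz j) (sub_pos.2 ht1)
    have h2 := mul_le_mul_of_nonneg_left (hy j hj) ht0.le
    linarith


lemma activeSet_tightSet_singleton (h : IsIrredundantSystem c b) (i : Fin m) :
    activeSet c b (tightSet c b {i}) = {i} := by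
  refine Finset.Subset.antisymm (fun j hj => ?_) (subset_activeSet_tightSet _)
  obtain ⟨w, hwi, hw⟩ := exists_wall_point h i
  by_contra hji
  rw [Finset.mem_singleton] at hji
  have hwmem : w ∈ tightSet c b {i} := by
    refine ⟨fun k => ?_, fun k hk => by rw [Finset.mem_singleton.1 hk, hwi]⟩
    by_cases hk : k = i
    · rw [hk, hwi]
    · exact (hw k hk).le
  exact (hw j hji).ne' (mem_activeSet.1 hj w hwmem)

lemma tightSet_singleton_nonempty (h : IsIrredundantSystem c b) (i : Fin m) :
    (tightSet c b {i}).Nonempty := by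
  obtain ⟨w, hwi, hw⟩ := exists_wall_point h i
  refine ⟨w, fun k => ?_, fun k hk => by rw [Finset.mem_singleton.1 hk, hwi]⟩
  by_cases hk : k = i
  · rw [hk, hwi]
  · exact (hw k hk).le

lemma affDim_face {F : Set (Fin n → ℝ)} (hF : IsNonemptyFace (solutionSet c b) F) :
    affDim F = Module.finrank ℝ (LinearMap.ker (normalMap c (activeSet c b F))) := by
  rw [affDim, vectorSpan_face hF]

lemma finrank_ker_normalMap_singleton (h : IsIrredundantSystem c b) (i : Fin m) :
    Module.finrank ℝ (LinearMap.ker (normalMap c {i})) + 1 = n := by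
  obtain ⟨z, hz⟩ := exists_strict_solution h
  obtain ⟨w, hwi, -⟩ := exists_wall_point h i
  have hpos : 0 < c i ⬝ᵥ (z - w) := by
    rw [dotProduct_sub, hwi]
    linarith [hz i]
  have hsurj : Function.Surjective (normalMap c {i}) := by
    intro y
    refine ⟨(y ⟨i, Finset.mem_singleton_self i⟩ / (c i ⬝ᵥ (z - w))) • (z - w), ?_⟩
    ext ⟨j, hj⟩
    obtain rfl := Finset.mem_singleton.1 hj
    rw [normalMap_apply, dotProduct_smul, smul_eq_mul, div_mul_cancel₀ _ hpos.ne']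
  have := LinearMap.finrank_range_add_finrank_ker (normalMap c {i})
  rw [LinearMap.range_eq_top.2 hsurj, finrank_top, Module.finrank_fin_fun,
    Module.finrank_fintype_fun_eq_card, Fintype.card_coe, Finset.card_singleton] at this
  omega

lemma isFacet_tightSet_singleton (h : IsIrredundantSystem c b) (i : Fin m) :
    IsFacet (solutionSet c b) (tightSet c b {i}) := by
  have hface := isNonemptyFace_tightSet (tightSet_singleton_nonempty h i)
  refine ⟨hface, ?_⟩
  rw [affDim_face hface, activeSet_tightSet_singleton h]
  exact finrank_ker_normalMap_singleton h i

/-- The facets are exactly the solution sets of the single equations. -/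
lemma exists_eq_tightSet_singleton (h : IsIrredundantSystem c b) {H : Set (Fin n → ℝ)}
    (hH : IsFacet (solutionSet c b) H) : ∃ i, H = tightSet c b {i} := by
  have hdim := hH.2
  rw [affDim_face hH.1] at hdim
  have hJne : (activeSet c b H).Nonempty := by
    by_contra hempty
    rw [Finset.not_nonempty_iff_eq_empty] at hempty
    have htop : LinearMap.ker (normalMap c (activeSet c b H)) = ⊤ := by
      rw [eq_top_iff]
      intro v _
      rw [mem_ker_normalMap, hempty]
      simp
    rw [htop, finrank_top, Module.finrank_fin_fun] at hdim
    omega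
  obtain ⟨i, hi⟩ := hJne
  have hle : LinearMap.ker (normalMap c (activeSet c b H)) ≤ LinearMap.ker (normalMap c {i}) := by
    intro v hv
    rw [mem_ker_normalMap] at hv ⊢
    intro j hj
    rw [Finset.mem_singleton.1 hj]
    exact hv i hi
  have heq := Submodule.eq_of_le_of_finrank_eq hle
    (by have := finrank_ker_normalMap_singleton h i; omega)
  obtain ⟨w, hwi, hw⟩ := exists_wall_point h i
  obtain ⟨x, hx⟩ := hH.1.1
  -- The difference of the wall point and a point of `H` is parallel to the hyperplane of `i`,
  -- hence to all hyperplanes containing `H`, so that no inequality but `i` is active on `H`.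
  have hsub : activeSet c b H = {i} := by
    refine Finset.Subset.antisymm (fun j hj => ?_) (Finset.singleton_subset_iff.2 hi)
    by_contra hji
    rw [Finset.mem_singleton] at hji
    have hmem : w - x ∈ LinearMap.ker (normalMap c {i}) := by
      rw [mem_ker_normalMap]
      intro k hk
      rw [Finset.mem_singleton.1 hk, dotProduct_sub, hwi, mem_activeSet.1 hi x hx, sub_self]
    rw [← heq, mem_ker_normalMap] at hmem
    have := hmem j hj
    rw [dotProduct_sub, mem_activeSet.1 hj x hx] at this
    linarith [hw j hji]
  exact ⟨i, by rw [← hsub]; exact face_eq_tightSet hH.1⟩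

lemma tightSet_singleton_injective (h : IsIrredundantSystem c b) :
    Function.Injective fun i => tightSet c b {i} := by
  intro i j hij
  have := congrArg (activeSet c b) hij
  simpa [activeSet_tightSet_singleton h] using this

/-- The facets containing a face correspond to its active inequalities. -/
lemma ncard_facets_containing (h : IsIrredundantSystem c b) {F : Set (Fin n → ℝ)}
    (hF : IsNonemptyFace (solutionSet c b) F) :
    {H | IsFacet (solutionSet c b) H ∧ F ⊆ H}.ncard = (activeSet c b F).card := by
  have : {H | IsFacet (solutionSet c b) H ∧ F ⊆ H} =
      (fun i => tightSet c b {i}) '' (activeSet c b F : Set (Fin m)) := by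
    ext H
    simp only [Set.mem_ofPred_eq, Set.mem_image, Finset.mem_coe]
    constructor
    · rintro ⟨hH, hsub⟩
      obtain ⟨i, rfl⟩ := exists_eq_tightSet_singleton h hH
      exact ⟨i, mem_activeSet.2 fun x hx => (hsub hx).2 i (Finset.mem_singleton_self i), rfl⟩
    · rintro ⟨i, hi, rfl⟩
      refine ⟨isFacet_tightSet_singleton h i, fun x hx => ⟨hF.2.subset hx, fun j hj => ?_⟩⟩
      rw [Finset.mem_singleton.1 hj]
      exact mem_activeSet.1 hi x hx
  rw [this, Set.ncard_image_of_injective _ (tightSet_singleton_injective h), Set.ncard_coe_finset]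

/-- In the simple case the normals of the inequalities active on a face are independent, so that
the active inequalities can be relaxed separately: a tight set determines its indices. -/
lemma activeSet_tightSet (h : IsIrredundantSystem c b)
    (hsimple : ∀ F, IsNonemptyFace (solutionSet c b) F →
      {H | IsFacet (solutionSet c b) H ∧ F ⊆ H}.ncard + affDim F = n)
    {J : Finset (Fin m)} (hJ : (tightSet c b J).Nonempty) :
    activeSet c b (tightSet c b J) = J := by
  classical
  obtain ⟨F, hFJ⟩ : ∃ F, F = tightSet c b J := ⟨_, rfl⟩
  have hF : IsNonemptyFace (solutionSet c b) F := hFJ ▸ isNonemptyFace_tightSet hJ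
  rw [← hFJ]
  refine Finset.Subset.antisymm (fun j hj => ?_) (hFJ ▸ subset_activeSet_tightSet J)
  by_contra hjJ
  have hdim := hsimple F hF
  rw [ncard_facets_containing h hF, affDim_face hF] at hdim
  have hrank := LinearMap.finrank_range_add_finrank_ker (normalMap c (activeSet c b F))
  rw [Module.finrank_fin_fun] at hrank
  have hsurj : LinearMap.range (normalMap c (activeSet c b F)) = ⊤ :=
    Submodule.eq_top_of_finrank_eq (by
      rw [Module.finrank_fintype_fun_eq_card, Fintype.card_coe]; omega)
  obtain ⟨v, hv⟩ := LinearMap.range_eq_top.1 hsurj (Pi.single ⟨j, hj⟩ 1)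
  have hvj : c j ⬝ᵥ v = 1 := by
    rw [← normalMap_apply (activeSet c b F) v ⟨j, hj⟩, hv, Pi.single_eq_same]
  have hvi : ∀ i ∈ activeSet c b F, i ≠ j → c i ⬝ᵥ v = 0 := by
    intro i hi hij
    rw [← normalMap_apply (activeSet c b F) v ⟨i, hi⟩, hv, Pi.single_eq_of_ne]
    simpa using hij
  obtain ⟨x, hxF, hx⟩ := exists_generic_point hF.2.subset (convex_of_isExposed hF) hF.1
  obtain ⟨ε, hε, hmem⟩ := exists_small_step (v := v) (hF.2.subset hxF) (fun i hi => by
    by_cases hij : i = j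
    · rw [hij, hvj]
      exact zero_le_one
    · rw [hvi i (mem_activeSet_of_generic hF.2.subset hx hi) hij])
  have hstep : x + ε • v ∈ F := by
    rw [hFJ] at hxF ⊢
    refine ⟨hmem, fun i hi => ?_⟩
    have hiF : i ∈ activeSet c b F := hFJ ▸ subset_activeSet_tightSet J hi
    rw [dotProduct_add, dotProduct_smul, hvi i hiF (fun hij => hjJ (hij ▸ hi)), hxF.2 i hi,
      smul_zero, add_zero]
  have h1 := mem_activeSet.1 hj _ hstep
  rw [dotProduct_add, dotProduct_smul, hvj, mem_activeSet.1 hj x hxF, smul_eq_mul] at h1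
  linarith

end Irredundant

namespace SimplePolyhedron

variable {n : ℕ} (P : SimplePolyhedron n)

lemma affDim_le (F : Set (Fin n → ℝ)) : affDim F ≤ n := by
  have := Submodule.finrank_le (vectorSpan ℝ F)
  rwa [Module.finrank_fin_fun] at this

lemma fVector_eq_zero {k : ℕ} (hk : n < k) : P.fVector k = 0 := by
  have : {F | IsNonemptyFace P.carrier F ∧ affDim F = k} = ∅ := by
    ext F
    simp only [Set.mem_ofPred_eq, Set.mem_empty_iff_false, iff_false, not_and]
    intro _ h
    have := affDim_le F
    omega
  rw [fVector, this, Set.ncard_empty]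

/-- The nonempty faces of dimension `k` of a simple polyhedron correspond to the sets of `n - k`
facets with nonempty common intersection. -/
theorem fVector_eq_dualComplex_fVector {k : ℕ} (hk : k ≤ n) :
    P.fVector k = P.dualComplex.fVector (n - k) := by
  classical
  obtain ⟨m, c, b, hP, hirr⟩ := P.isPolyhedron.exists_irredundant
  have h : IsIrredundantSystem c b :=
    ⟨hP ▸ P.full_dim, hP ▸ P.nonempty, hirr⟩
  have hsimple := P.simple
  rw [hP] at hsimple
  let K : Set (Finset (Fin m)) := {J | (tightSet c b J).Nonempty ∧ J.card = n - k}
  -- Both kinds of faces are parametrized by sets of inequalities that are simultaneously tight.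
  have hfaces : {F | IsNonemptyFace P.carrier F ∧ affDim F = k} = tightSet c b '' K := by
    ext F
    simp only [Set.mem_ofPred_eq, Set.mem_image, K]
    rw [hP]
    constructor
    · rintro ⟨hF, hdim⟩
      refine ⟨activeSet c b F, ⟨by rw [← face_eq_tightSet hF]; exact hF.1, ?_⟩,
        (face_eq_tightSet hF).symm⟩
      have := hsimple F hF
      rw [ncard_facets_containing h hF] at this
      omega
    · rintro ⟨J, ⟨hJ, hcard⟩, rfl⟩
      have hF := isNonemptyFace_tightSet hJ
      refine ⟨hF, ?_⟩
      have := hsimple _ hF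
      rw [ncard_facets_containing h hF, activeSet_tightSet h hsimple hJ] at this
      omega
  have hinj : Set.InjOn (tightSet c b) K := by
    intro J hJ J' hJ' heq
    rw [← activeSet_tightSet h hsimple hJ.1, heq, activeSet_tightSet h hsimple hJ'.1]
  let e : Fin m ↪ {F : Set (Fin n → ℝ) // IsFacet P.carrier F} :=
    ⟨fun i => ⟨tightSet c b {i}, by rw [hP]; exact isFacet_tightSet_singleton h i⟩, fun i j hij =>
      tightSet_singleton_injective h (congrArg Subtype.val hij)⟩
  have hsurj : Function.Surjective e := by
    rintro ⟨H, hH⟩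
    obtain ⟨i, hi⟩ := exists_eq_tightSet_singleton h (hP ▸ hH)
    exact ⟨i, Subtype.ext hi.symm⟩
  have hinter : ∀ J : Finset (Fin m),
      P.carrier ∩ ⋂ F ∈ J.map e, F.1 = tightSet c b J := by
    intro J
    ext x
    simp only [Set.mem_inter_iff, Set.mem_iInter, Finset.mem_map, hP]
    constructor
    · rintro ⟨hx, hall⟩
      exact ⟨hx, fun i hi => (hall (e i) ⟨i, hi, rfl⟩).2 i (Finset.mem_singleton_self i)⟩
    · rintro ⟨hx, hall⟩
      refine ⟨hx, ?_⟩
      rintro _ ⟨i, hi, rfl⟩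
      exact ⟨hx, fun j hj => by rw [Finset.mem_singleton.1 hj]; exact hall i hi⟩
  have hdual : {A | A ∈ P.dualComplex.faces ∧ A.card = n - k} =
      (fun J : Finset (Fin m) => J.map e) '' K := by
    ext A
    simp only [Set.mem_ofPred_eq, Set.mem_image, K]
    constructor
    · rintro ⟨hA, hcard⟩
      obtain ⟨J, rfl⟩ : ∃ J : Finset (Fin m), J.map e = A := by
        refine ⟨A.preimage e e.injective.injOn, ?_⟩
        ext F
        obtain ⟨i, rfl⟩ := hsurj F
        simp
      rw [Finset.card_map] at hcard
      refine ⟨J, ⟨?_, hcard⟩, rfl⟩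
      rw [← hinter]
      exact hA
    · rintro ⟨J, ⟨hJ, hcard⟩, rfl⟩
      refine ⟨?_, by rw [Finset.card_map, hcard]⟩
      change (P.carrier ∩ ⋂ F ∈ J.map e, F.1).Nonempty
      rw [hinter]
      exact hJ
  rw [fVector, FaceComplex.fVector, hfaces, hdual, hinj.ncard_image,
    Set.ncard_image_of_injective _ (Finset.map_injective e)]

end SimplePolyhedron

lemma FaceComplex.Isomorphic.fVector_eq {S T : Type*} {Δ : FaceComplex S} {Γ : FaceComplex T}
    (h : Δ.Isomorphic Γ) (k : ℕ) : Δ.fVector k = Γ.fVector k := by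
  obtain ⟨e, he⟩ := h
  have : {A | A ∈ Γ.faces ∧ A.card = k} =
      (fun A : Finset S => A.map e.toEmbedding) '' {A | A ∈ Δ.faces ∧ A.card = k} := by
    ext A
    simp only [Set.mem_ofPred_eq, Set.mem_image]
    constructor
    · rintro ⟨hA, hcard⟩
      have hmap : (A.map e.symm.toEmbedding).map e.toEmbedding = A := by
        ext x
        simp
      exact ⟨A.map e.symm.toEmbedding, ⟨(he _).2 (hmap.symm ▸ hA), by rw [Finset.card_map, hcard]⟩,
        hmap⟩
    · rintro ⟨B, ⟨hB, hcard⟩, rfl⟩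
      exact ⟨(he B).1 hB, by rw [Finset.card_map, hcard]⟩
  rw [FaceComplex.fVector, FaceComplex.fVector, this,
    Set.ncard_image_of_injective _ (Finset.map_injective _)]

/-! ### Generating functions of cliques -/

section CliqueSum

/-- A finite set whose distinct elements are pairwise related by `r`. -/
def IsRelClique {α : Type*} (r : α → α → Prop) (T : Finset α) : Prop :=
  (T : Set α).Pairwise r

open Classical in
/-- The generating function `∑ s ^ #T` of the cliques `T ⊆ V` of a relation `r`. -/
def cliqueSum {R α : Type*} [CommSemiring R] (s : R) (V : Finset α) (r : α → α → Prop) : R :=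
  ∑ T ∈ V.powerset.filter (IsRelClique r), s ^ T.card

variable {R α β : Type*} [CommSemiring R] (s : R)

lemma cliqueSum_empty (r : α → α → Prop) : cliqueSum s ∅ r = 1 := by
  classical
  simp [cliqueSum, Finset.filter_singleton, IsRelClique]

lemma cliqueSum_image [DecidableEq β] {V : Finset α} {r : α → α → Prop} {r' : β → β → Prop}
    {f : α → β} (hf : Set.InjOn f V)
    (hr : ∀ x ∈ V, ∀ y ∈ V, x ≠ y → (r' (f x) (f y) ↔ r x y)) :
    cliqueSum s (V.image f) r' = cliqueSum s V r := by
  classical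
  symm
  refine Finset.sum_bij (fun T _ => T.image f) ?_ ?_ ?_ ?_
  · intro T hT
    rw [Finset.mem_filter, Finset.mem_powerset] at hT ⊢
    refine ⟨Finset.image_subset_image hT.1, ?_⟩
    rw [IsRelClique, Finset.coe_image]
    rintro _ ⟨x, hx, rfl⟩ _ ⟨y, hy, rfl⟩ hne
    have hxy : x ≠ y := fun h => hne (h ▸ rfl)
    exact (hr x (hT.1 hx) y (hT.1 hy) hxy).2 (hT.2 hx hy hxy)
  · intro T hT T' hT' heq
    rw [Finset.mem_filter, Finset.mem_powerset] at hT hT'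
    have := congrArg (fun A : Finset β => (A : Set β)) heq
    simp only [Finset.coe_image] at this
    exact Finset.coe_injective ((hf.image_eq_image_iff hT.1 hT'.1).1 this)
  · intro T hT
    rw [Finset.mem_filter, Finset.mem_powerset, Finset.subset_image_iff] at hT
    obtain ⟨⟨U, hU, rfl⟩, hT⟩ := hT
    refine ⟨U, ?_, rfl⟩
    rw [Finset.mem_filter, Finset.mem_powerset]
    refine ⟨hU, fun x hx y hy hxy => (hr x (hU hx) y (hU hy) hxy).1 (hT ?_ ?_ ?_)⟩
    · exact Finset.mem_coe.2 (Finset.mem_image_of_mem f hx)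
    · exact Finset.mem_coe.2 (Finset.mem_image_of_mem f hy)
    · exact fun h => hxy (hf (hU hx) (hU hy) h)
  · intro T hT
    rw [Finset.mem_filter, Finset.mem_powerset] at hT
    rw [Finset.card_image_of_injOn (hf.mono hT.1)]

lemma cliqueSum_union [DecidableEq α] {A B : Finset α} {r : α → α → Prop} (hAB : Disjoint A B)
    (hr : ∀ a ∈ A, ∀ b ∈ B, r a b ∧ r b a) :
    cliqueSum s (A ∪ B) r = cliqueSum s A r * cliqueSum s B r := by
  classical
  rw [cliqueSum, cliqueSum, cliqueSum, Finset.sum_mul_sum, ← Finset.sum_product']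
  symm
  refine Finset.sum_bij' (fun p _ => p.1 ∪ p.2) (fun T _ => (T ∩ A, T ∩ B)) ?_ ?_ ?_ ?_ ?_
  · rintro ⟨T, U⟩ h
    simp only [Finset.mem_product, Finset.mem_filter, Finset.mem_powerset] at h ⊢
    refine ⟨Finset.union_subset_union h.1.1 h.2.1, ?_⟩
    rw [IsRelClique, Finset.coe_union, Set.pairwise_union]
    exact ⟨h.1.2, h.2.2, fun a ha b hb _ => hr a (h.1.1 ha) b (h.2.1 hb)⟩
  · intro T h
    simp only [Finset.mem_product, Finset.mem_filter, Finset.mem_powerset] at h ⊢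
    exact ⟨⟨Finset.inter_subset_right, h.2.mono (Finset.coe_subset.2 Finset.inter_subset_left)⟩,
      ⟨Finset.inter_subset_right, h.2.mono (Finset.coe_subset.2 Finset.inter_subset_left)⟩⟩
  · rintro ⟨T, U⟩ h
    simp only [Finset.mem_product, Finset.mem_filter, Finset.mem_powerset] at h ⊢
    ext x
    · have h1 : x ∈ T → x ∈ A := fun hx => h.1.1 hx
      have h2 : x ∈ U → x ∈ B := fun hx => h.2.1 hx
      have h3 : x ∈ A → x ∉ B := fun hx => Finset.disjoint_left.1 hAB hx
      simp only [Finset.mem_inter, Finset.mem_union]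
      tauto
    · have h1 : x ∈ T → x ∈ A := fun hx => h.1.1 hx
      have h2 : x ∈ U → x ∈ B := fun hx => h.2.1 hx
      have h3 : x ∈ A → x ∉ B := fun hx => Finset.disjoint_left.1 hAB hx
      simp only [Finset.mem_inter, Finset.mem_union]
      tauto
  · intro T h
    simp only [Finset.mem_filter, Finset.mem_powerset] at h
    rw [← Finset.inter_union_distrib_left, Finset.inter_eq_left.2 h.1]
  · rintro ⟨T, U⟩ h
    simp only [Finset.mem_product, Finset.mem_filter, Finset.mem_powerset] at h
    rw [Finset.card_union_of_disjoint (Finset.disjoint_of_subset_left h.1.1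
      (Finset.disjoint_of_subset_right h.2.1 hAB)), pow_add]

/-- Cliques are sorted by their member of largest `size` satisfying `p`, if there is one; the
members of a clique satisfying `p` are supposed to have different sizes. -/
lemma cliqueSum_eq_add_sum {V : Finset α} {r : α → α → Prop} (p : α → Prop) (size : α → ℕ)
    (V₀ W : Finset α) (U : α → Finset α) (hsymm : ∀ x ∈ V, ∀ y ∈ V, r x y → r y x)
    (hsize : ∀ x ∈ V, ∀ y ∈ V, p x → p y → x ≠ y → r x y → size x ≠ size y)
    (hV₀ : ∀ u, u ∈ V₀ ↔ u ∈ V ∧ ¬p u) (hW : ∀ u, u ∈ W ↔ u ∈ V ∧ p u)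
    (hU : ∀ w ∈ W, ∀ u, u ∈ U w ↔ u ∈ V ∧ u ≠ w ∧ r u w ∧ ¬(p u ∧ size w < size u)) :
    cliqueSum s V r = cliqueSum s V₀ r + s * ∑ w ∈ W, cliqueSum s (U w) r := by
  classical
  obtain rfl : V₀ = V.filter fun u => ¬p u := by
    ext u
    rw [hV₀, Finset.mem_filter]
  obtain rfl : W = V.filter p := by
    ext u
    rw [hW, Finset.mem_filter]
  have hUw : ∀ w ∈ V.filter p, cliqueSum s (U w) r =
      cliqueSum s (V.filter fun u => u ≠ w ∧ r u w ∧ ¬(p u ∧ size w < size u)) r := by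
    intro w hw
    congr 1
    ext u
    rw [hU w hw, Finset.mem_filter]
  rw [Finset.sum_congr rfl hUw]
  rw [cliqueSum, ← Finset.sum_filter_add_sum_filter_not _ (fun T : Finset α => ∀ u ∈ T, ¬p u)]
  congr 1
  · rw [cliqueSum]
    refine Finset.sum_congr ?_ fun _ _ => rfl
    ext T
    simp only [Finset.mem_filter, Finset.mem_powerset, Finset.subset_iff]
    constructor
    · rintro ⟨⟨h1, h2⟩, h3⟩
      exact ⟨fun x hx => ⟨h1 hx, h3 x hx⟩, h2⟩
    · rintro ⟨h1, h2⟩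
      exact ⟨⟨fun x hx => (h1 hx).1, h2⟩, fun x hx => (h1 hx).2⟩
  · simp only [cliqueSum]
    rw [Finset.mul_sum]
    simp only [Finset.mul_sum]
    rw [Finset.sum_sigma']
    symm
    refine Finset.sum_bij (fun q _ => insert q.1 q.2) ?_ ?_ ?_ ?_
    · rintro ⟨w, T⟩ h
      simp only [Finset.mem_sigma, Finset.mem_filter, Finset.mem_powerset] at h ⊢
      obtain ⟨⟨hwV, hpw⟩, hT, hpair⟩ := h
      refine ⟨⟨?_, ?_⟩, fun hall => hall w (Finset.mem_insert_self _ _) hpw⟩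
      · rw [Finset.insert_subset_iff]
        exact ⟨hwV, hT.trans (Finset.filter_subset _ _)⟩
      · rw [IsRelClique, Finset.coe_insert, Set.pairwise_insert]
        refine ⟨hpair, fun u hu hne => ?_⟩
        have := Finset.mem_filter.1 (hT hu)
        exact ⟨hsymm u this.1 w hwV this.2.2.1, this.2.2.1⟩
    · rintro ⟨w, T⟩ h ⟨w', T'⟩ h' heq
      simp only [Finset.mem_sigma, Finset.mem_filter, Finset.mem_powerset] at h h'
      have hwT : ∀ u ∈ T, u ≠ w ∧ ¬(p u ∧ size w < size u) ∧ u ∈ V ∧ r u w := fun u hu => by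
        have := Finset.mem_filter.1 (h.2.1 hu)
        exact ⟨this.2.1, this.2.2.2, this.1, this.2.2.1⟩
      have hwT' : ∀ u ∈ T', u ≠ w' ∧ ¬(p u ∧ size w' < size u) ∧ u ∈ V ∧ r u w' := fun u hu => by
        have := Finset.mem_filter.1 (h'.2.1 hu)
        exact ⟨this.2.1, this.2.2.2, this.1, this.2.2.1⟩
      simp only at heq
      have hww : w = w' := by
        by_contra hne
        have h1 : w' ∈ insert w T := by rw [heq]; exact Finset.mem_insert_self _ _
        have h2 : w ∈ insert w' T' := by rw [← heq]; exact Finset.mem_insert_self _ _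
        have h1' := hwT w' ((Finset.mem_insert.1 h1).resolve_left (Ne.symm hne))
        have h2' := hwT' w ((Finset.mem_insert.1 h2).resolve_left hne)
        have h3 := hsize w' h'.1.1 w h.1.1 h'.1.2 h.1.2 (Ne.symm hne) h1'.2.2.2
        have h4 : ¬size w < size w' := fun hlt => h1'.2.1 ⟨h'.1.2, hlt⟩
        have h5 : ¬size w' < size w := fun hlt => h2'.2.1 ⟨h.1.2, hlt⟩
        omega
      subst hww
      have hTT : T = T' := by
        have := congrArg (fun A => A.erase w) heq
        rwa [Finset.erase_insert fun hw => (hwT w hw).1 rfl,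
          Finset.erase_insert fun hw => (hwT' w hw).1 rfl] at this
      rw [hTT]
    · intro T hT
      simp only [Finset.mem_filter, Finset.mem_powerset] at hT
      obtain ⟨⟨hTV, hpair⟩, hex⟩ := hT
      push Not at hex
      have hne : (T.filter p).Nonempty := by
        obtain ⟨u, hu, hpu⟩ := hex
        exact ⟨u, Finset.mem_filter.2 ⟨hu, hpu⟩⟩
      obtain ⟨w, hw, hmax⟩ := Finset.exists_max_image _ size hne
      rw [Finset.mem_filter] at hw
      refine ⟨⟨w, T.erase w⟩, ?_, Finset.insert_erase hw.1⟩
      simp only [Finset.mem_sigma, Finset.mem_filter, Finset.mem_powerset]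
      refine ⟨⟨hTV hw.1, hw.2⟩, fun u hu => ?_,
        hpair.mono (Finset.coe_subset.2 (Finset.erase_subset _ _))⟩
      rw [Finset.mem_erase] at hu
      rw [Finset.mem_filter]
      refine ⟨hTV hu.2, hu.1, hpair hu.2 hw.1 hu.1, fun hlt => ?_⟩
      have := hmax u (Finset.mem_filter.2 ⟨hu.2, hlt.1⟩)
      omega
    · rintro ⟨w, T⟩ h
      simp only [Finset.mem_sigma, Finset.mem_filter, Finset.mem_powerset] at h
      have hw : w ∉ T := fun hw => (Finset.mem_filter.1 (h.2.1 hw)).2.1 rfl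
      rw [Finset.card_insert_of_notMem hw, pow_succ']

end CliqueSum

/-! ### Tubings of paths and of signed paths -/

section Intervals

/-- The intervals `[a, b)` with `a < b ≤ N`, encoded as pairs `(a, b)`: the tubes of the path on
the vertices `0, …, N - 1`. -/
def intervals (N : ℕ) : Finset (ℕ × ℕ) :=
  (Finset.range (N + 1) ×ˢ Finset.range (N + 1)).filter fun u => u.1 < u.2

/-- The tubes of a path other than the whole path. -/
def properIntervals (N : ℕ) : Finset (ℕ × ℕ) :=
  (intervals N).erase (0, N)

/-- Two intervals are nested or at a distance. -/
def IntervalCompatible (u w : ℕ × ℕ) : Prop :=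
  (w.1 ≤ u.1 ∧ u.2 ≤ w.2) ∨ (u.1 ≤ w.1 ∧ w.2 ≤ u.2) ∨ u.2 < w.1 ∨ w.2 < u.1

/-- Compatibility of intervals with a sign, the tubes of two antipodal copies of a path: those of
equal sign must be compatible, those of opposite sign must be disjoint. -/
def SignedCompatible (u w : Bool × ℕ × ℕ) : Prop :=
  (u.1 = w.1 ∧ IntervalCompatible u.2 w.2) ∨ (u.1 ≠ w.1 ∧ (u.2.2 ≤ w.2.1 ∨ w.2.2 ≤ u.2.1))

/-- The signed intervals in a path on `N` vertices. If `l` is a sign, the intervals of this sign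
must not start at the left end; if `r` is a sign, those of this sign must not stop at the right
end. The value `none` stands for no restriction. -/
def signedIntervals (N : ℕ) (l r : Option Bool) : Finset (Bool × ℕ × ℕ) :=
  (Finset.univ ×ˢ intervals N).filter fun u =>
    (u.2.1 = 0 → l ≠ some u.1) ∧ (u.2.2 = N → r ≠ some u.1)

lemma mem_intervals {N : ℕ} {u : ℕ × ℕ} : u ∈ intervals N ↔ u.1 < u.2 ∧ u.2 ≤ N := by
  simp only [intervals, Finset.mem_filter, Finset.mem_product, Finset.mem_range]
  omega

lemma mem_properIntervals {N : ℕ} {u : ℕ × ℕ} :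
    u ∈ properIntervals N ↔ u.1 < u.2 ∧ u.2 ≤ N ∧ (u.1 = 0 → u.2 ≠ N) := by
  simp only [properIntervals, Finset.mem_erase, mem_intervals, ne_eq, Prod.ext_iff]
  tauto

lemma mem_signedIntervals {N : ℕ} {l r : Option Bool} {u : Bool × ℕ × ℕ} :
    u ∈ signedIntervals N l r ↔ (u.2.1 < u.2.2 ∧ u.2.2 ≤ N) ∧
      (u.2.1 = 0 → l ≠ some u.1) ∧ (u.2.2 = N → r ≠ some u.1) := by
  simp [signedIntervals, mem_intervals]

variable {R : Type*} [CommSemiring R] (s : R)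

/-- The generating function of the tubings of a path by tubes other than the whole path. -/
def properPathSum (N : ℕ) : R := cliqueSum s (properIntervals N) IntervalCompatible

/-- The generating function of the tubings of a path. -/
def pathSum (N : ℕ) : R := cliqueSum s (intervals N) IntervalCompatible

/-- The generating function of the sets of compatible signed intervals. -/
def signedPathSum (l r : Option Bool) (N : ℕ) : R :=
  cliqueSum s (signedIntervals N l r) SignedCompatible

lemma pathSum_zero : pathSum s 0 = 1 := by
  have : intervals 0 = ∅ := by
    ext u
    simp only [mem_intervals, Finset.notMem_empty, iff_false]
    omega
  rw [pathSum, this, cliqueSum_empty]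

lemma pathSum_eq {N : ℕ} (hN : 0 < N) : pathSum s N = (1 + s) * properPathSum s N := by
  rw [pathSum, cliqueSum_eq_add_sum s (fun u => u = (0, N)) (fun _ => 0) (properIntervals N)
    {(0, N)} (fun _ => properIntervals N), Finset.sum_singleton, ← properPathSum]
  · ring
  · intro x _ y _
    simp only [IntervalCompatible]
    omega
  · rintro x _ y _ rfl rfl h
    exact absurd rfl h
  · intro u
    simp [properIntervals, and_comm]
  · intro u
    rw [Finset.mem_singleton, mem_intervals]
    constructor
    · rintro rfl
      exact ⟨⟨hN, le_rfl⟩, rfl⟩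
    · exact fun h => h.2
  · intro w hw u
    rw [Finset.mem_singleton.1 hw]
    simp only [mem_properIntervals, IntervalCompatible, mem_intervals, ne_eq, Prod.ext_iff]
    omega

/-- Translation of intervals. -/
def shift (k : ℕ) (u : ℕ × ℕ) : ℕ × ℕ := (u.1 + k, u.2 + k)

lemma shift_injective (k : ℕ) : Function.Injective (shift k) := by
  rintro ⟨a, b⟩ ⟨a', b'⟩ h
  simp only [shift, Prod.mk.injEq] at h ⊢
  omega

lemma intervalCompatible_shift {k : ℕ} {u w : ℕ × ℕ} :
    IntervalCompatible (shift k u) (shift k w) ↔ IntervalCompatible u w := by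
  simp only [IntervalCompatible, shift]
  omega

lemma mem_image_shift_intervals {N k : ℕ} {u : ℕ × ℕ} :
    u ∈ (intervals N).image (shift k) ↔ k ≤ u.1 ∧ u.1 < u.2 ∧ u.2 ≤ N + k := by
  simp only [Finset.mem_image, mem_intervals]
  constructor
  · rintro ⟨w, hw, rfl⟩
    simp only [shift]
    omega
  · intro h
    refine ⟨(u.1 - k, u.2 - k), ?_, ?_⟩
    · simp only
      omega
    · simp only [shift, Prod.ext_iff]
      omega

lemma cliqueSum_image_shift (N k : ℕ) :
    cliqueSum s ((intervals N).image (shift k)) IntervalCompatible = pathSum s N :=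
  cliqueSum_image s (shift_injective k).injOn fun _ _ _ _ _ => intervalCompatible_shift

/-- Tubings of a path are sorted by the largest tube `[0, j)` containing the first vertex. -/
lemma properPathSum_succ (N : ℕ) :
    properPathSum s (N + 1) = pathSum s N +
      s * ∑ j ∈ Finset.Icc 1 N, properPathSum s j * pathSum s (N - j) := by
  rw [properPathSum, cliqueSum_eq_add_sum s (fun u => u.1 = 0) (fun u => u.2)
    ((intervals N).image (shift 1)) ((Finset.Icc 1 N).image fun j => (0, j))
    (fun w => properIntervals w.2 ∪ (intervals (N - w.2)).image (shift (w.2 + 1))),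
    cliqueSum_image_shift, Finset.sum_image fun _ _ _ _ h => (Prod.ext_iff.1 h).2]
  · congr 2
    refine Finset.sum_congr rfl fun j hj => ?_
    rw [cliqueSum_union, cliqueSum_image_shift, properPathSum]
    · rw [Finset.disjoint_left]
      intro u
      rw [mem_image_shift_intervals, mem_properIntervals]
      omega
    · intro u hu w hw
      rw [mem_image_shift_intervals] at hw
      rw [mem_properIntervals] at hu
      simp only [IntervalCompatible]
      omega
  · intro x _ y _
    simp only [IntervalCompatible]
    omega
  · intro x hx y hy hx0 hy0 hne _ heq
    exact hne (Prod.ext (hx0.trans hy0.symm) heq)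
  · intro u
    rw [mem_image_shift_intervals, mem_properIntervals]
    omega
  · rintro ⟨a, b⟩
    simp only [mem_properIntervals, Finset.mem_image, Finset.mem_Icc, Prod.mk.injEq]
    constructor
    · rintro ⟨j, hj, rfl, rfl⟩
      omega
    · intro h
      exact ⟨b, by omega⟩
  · intro w hw u
    obtain ⟨j, hj, rfl⟩ := Finset.mem_image.1 hw
    rw [Finset.mem_Icc] at hj
    rw [Finset.mem_union, mem_image_shift_intervals]
    simp only [mem_properIntervals, IntervalCompatible, ne_eq, Prod.ext_iff]
    omega

/-- Translation of signed intervals. -/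
def signedShift (k : ℕ) (u : Bool × ℕ × ℕ) : Bool × ℕ × ℕ := (u.1, shift k u.2)

lemma signedShift_injective (k : ℕ) : Function.Injective (signedShift k) := by
  rintro ⟨e, u⟩ ⟨e', u'⟩ h
  simp only [signedShift, Prod.mk.injEq] at h ⊢
  exact ⟨h.1, shift_injective k h.2⟩

lemma signedCompatible_shift {k : ℕ} {u w : Bool × ℕ × ℕ} :
    SignedCompatible (signedShift k u) (signedShift k w) ↔ SignedCompatible u w := by
  simp only [SignedCompatible, signedShift, intervalCompatible_shift]
  simp only [shift, Nat.add_le_add_iff_right]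

lemma mem_image_signedShift {N k : ℕ} {l r : Option Bool} {u : Bool × ℕ × ℕ} :
    u ∈ (signedIntervals N l r).image (signedShift k) ↔
      (k ≤ u.2.1 ∧ u.2.1 < u.2.2 ∧ u.2.2 ≤ N + k) ∧
        (u.2.1 = k → l ≠ some u.1) ∧ (u.2.2 = N + k → r ≠ some u.1) := by
  simp only [Finset.mem_image, mem_signedIntervals]
  constructor
  · rintro ⟨w, hw, rfl⟩
    simp only [signedShift, shift]
    refine ⟨by omega, fun h => hw.2.1 (by omega), fun h => hw.2.2 (by omega)⟩
  · intro h
    refine ⟨(u.1, u.2.1 - k, u.2.2 - k), ⟨?_, ?_, ?_⟩, ?_⟩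
    · simp only
      omega
    · exact fun h' => h.2.1 (by simp only at h'; omega)
    · exact fun h' => h.2.2 (by simp only at h'; omega)
    · simp only [signedShift, shift, Prod.ext_iff]
      exact ⟨trivial, by omega, by omega⟩

lemma cliqueSum_image_signedShift (N k : ℕ) (l r : Option Bool) :
    cliqueSum s ((signedIntervals N l r).image (signedShift k)) SignedCompatible =
      signedPathSum s l r N :=
  cliqueSum_image s (signedShift_injective k).injOn fun _ _ _ _ _ => signedCompatible_shift

lemma signedCompatible_symm {u w : Bool × ℕ × ℕ} (h : SignedCompatible u w) :
    SignedCompatible w u := by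
  simp only [SignedCompatible, IntervalCompatible] at h ⊢
  rcases h with ⟨h1, h2⟩ | ⟨h1, h2⟩
  · exact Or.inl ⟨h1.symm, by omega⟩
  · exact Or.inr ⟨h1.symm, by omega⟩

/-- Sets of signed intervals are sorted by the largest one `[0, j)` containing the first vertex;
to its right, an interval of the same sign must not start immediately. -/
lemma signedPathSum_succ (l r : Option Bool) (N : ℕ) :
    signedPathSum s l r (N + 1) = signedPathSum s none r N +
      s * ∑ e ∈ Finset.univ.filter (fun e => l ≠ some e),
        ∑ j ∈ (Finset.Icc 1 (N + 1)).filter (fun j => j = N + 1 → r ≠ some e),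
          properPathSum s j * signedPathSum s (some e) r (N + 1 - j) := by
  classical
  rw [signedPathSum, cliqueSum_eq_add_sum s (fun u => u.2.1 = 0) (fun u => u.2.2)
    ((signedIntervals N none r).image (signedShift 1))
    (((Finset.univ.filter (fun e => l ≠ some e)).sigma fun e =>
      (Finset.Icc 1 (N + 1)).filter (fun j => j = N + 1 → r ≠ some e)).image
        fun q => (q.1, 0, q.2))
    (fun w => (properIntervals w.2.2).image (fun u => (w.1, u)) ∪
      (signedIntervals (N + 1 - w.2.2) (some w.1) r).image (signedShift w.2.2)),
    cliqueSum_image_signedShift, Finset.sum_image, Finset.sum_sigma]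
  · congr 2
    refine Finset.sum_congr rfl fun e he => Finset.sum_congr rfl fun j hj => ?_
    rw [cliqueSum_union, cliqueSum_image_signedShift, cliqueSum_image, properPathSum]
    · exact fun u _ w _ h => (Prod.ext_iff.1 h).2
    · intro u _ w _ _
      simp [SignedCompatible]
    · rw [Finset.disjoint_left]
      intro u hu
      rw [mem_image_signedShift]
      simp only [Finset.mem_image, mem_properIntervals] at hu
      obtain ⟨u', hu', rfl⟩ := hu
      simp only
      omega
    · intro u hu w hw
      rw [mem_image_signedShift] at hw
      simp only [Finset.mem_image, mem_properIntervals] at hu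
      obtain ⟨u', hu', rfl⟩ := hu
      simp only at hw
      have hrel : SignedCompatible (e, u') w := by
        simp only [SignedCompatible, IntervalCompatible]
        by_cases hee : e = w.1
        · have : w.2.1 ≠ j := fun h => hw.2.1 h (congrArg some hee)
          exact Or.inl ⟨hee, by omega⟩
        · exact Or.inr ⟨hee, by omega⟩
      exact ⟨hrel, signedCompatible_symm hrel⟩
  · rintro ⟨e, j⟩ _ ⟨e', j'⟩ _ h
    simp only [Prod.mk.injEq] at h
    obtain ⟨rfl, -, rfl⟩ := h
    rfl
  · exact fun x _ y _ h => signedCompatible_symm h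
  · rintro ⟨e, a, b⟩ hx ⟨e', a', b'⟩ hy hx0 hy0 hne hrel heq
    simp only [mem_signedIntervals, SignedCompatible, IntervalCompatible] at hx hy hx0 hy0 hrel heq
    rcases hrel with h | h
    · exact hne (by simp [h.1, hx0, hy0, heq])
    · omega
  · intro u
    rw [mem_image_signedShift]
    simp only [mem_signedIntervals]
    constructor
    · rintro ⟨h1, h2, h3⟩
      exact ⟨⟨by omega, fun h => by omega, h3⟩, by omega⟩
    · rintro ⟨⟨h1, h2, h3⟩, h4⟩
      exact ⟨by omega, fun _ => by simp, h3⟩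
  · rintro ⟨e, a, b⟩
    simp only [Finset.mem_filter, mem_signedIntervals, Finset.mem_image, Finset.mem_sigma,
      Finset.mem_univ, true_and, Finset.mem_Icc, Prod.mk.injEq]
    constructor
    · rintro ⟨⟨e', j⟩, ⟨h1, h2, h3⟩, rfl, rfl, rfl⟩
      simp only at h1 h2 h3 ⊢
      exact ⟨⟨by omega, fun _ => h1, h3⟩, trivial⟩
    · rintro ⟨⟨h1, h2, h3⟩, h4⟩
      exact ⟨⟨e, b⟩, ⟨h2 h4, ⟨Nat.lt_of_le_of_lt (Nat.zero_le _) h1.1, h1.2⟩, h3⟩, rfl, h4.symm, rfl⟩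
  · intro w hw
    obtain ⟨⟨e, j⟩, hej, rfl⟩ := Finset.mem_image.1 hw
    simp only [Finset.mem_sigma, Finset.mem_filter, Finset.mem_univ, true_and,
      Finset.mem_Icc] at hej
    obtain ⟨he, hj⟩ := hej
    rintro ⟨e', a, b⟩
    rw [Finset.mem_union, mem_image_signedShift]
    simp only [mem_signedIntervals, Finset.mem_image, mem_properIntervals,
      SignedCompatible, IntervalCompatible, ne_eq, Prod.mk.injEq]
    constructor
    · rintro (⟨⟨a', b'⟩, ⟨h1, h2, h3⟩, rfl, rfl, rfl⟩ | ⟨h1, h2, h3⟩)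
      · simp only at h1 h2 h3
        refine ⟨⟨by omega, fun _ => he, fun h => hj.2 (by omega)⟩, fun h => h3 h.2.1 h.2.2,
          Or.inl ⟨rfl, by omega⟩, by omega⟩
      · refine ⟨⟨by omega, fun h => by omega, fun h => h3 (by omega)⟩, by omega, ?_, by omega⟩
        by_cases hee : e' = e
        · subst hee
          have : a ≠ j := fun h => h2 h rfl
          exact Or.inl ⟨rfl, by omega⟩
        · exact Or.inr ⟨hee, by omega⟩
    · rintro ⟨⟨h1, h2, h3⟩, h4, h5, h6⟩
      by_cases hb : b ≤ j
      · left
        have hee : e' = e := by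
          rcases h5 with h5 | h5
          · exact h5.1
          · omega
        subst hee
        exact ⟨(a, b), ⟨h1.1, hb, fun ha hbj => h4 ⟨rfl, ha, hbj⟩⟩, rfl, rfl⟩
      · right
        refine ⟨⟨?_, by omega⟩, ?_, fun h => h3 (by omega)⟩
        · rcases h5 with h5 | h5 <;> omega
        · intro ha heq
          rcases h5 with h5 | h5
          · omega
          · exact h5.1 (Option.some.inj heq).symm

lemma signedPathSum_zero (l r : Option Bool) : signedPathSum s l r 0 = 1 := by
  have : signedIntervals 0 l r = ∅ := by
    ext u
    simp only [mem_signedIntervals, Finset.notMem_empty, iff_false]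
    omega
  rw [signedPathSum, this, cliqueSum_empty]

end Intervals

/-! ### Generating functions in the number of vertices -/

section PowerSeries

open PowerSeries

variable {R : Type*} [CommRing R] (s : R)

/-- The generating function of the tubings of nonempty paths that contain the whole path. -/
def tubeSeries : PowerSeries R :=
  PowerSeries.mk fun m => if m = 0 then 0 else s * properPathSum s m

/-- The generating function of `signedPathSum`. -/
def signedPathSeries (l r : Option Bool) : PowerSeries R :=
  PowerSeries.mk (signedPathSum s l r)

/-- The generating function of what may stand to the right of a tube of sign `e`. It differs from
`signedPathSeries s (some e) r` in that the tube itself must not stop at the right end if `r`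
forbids its sign. -/
def afterTubeSeries (e : Bool) (r : Option Bool) : PowerSeries R :=
  PowerSeries.mk fun N => if N = 0 ∧ r = some e then 0 else signedPathSum s (some e) r N

lemma constantCoeff_tubeSeries : constantCoeff (tubeSeries s) = 0 := by
  rw [← coeff_zero_eq_constantCoeff_apply, tubeSeries, coeff_mk, if_pos rfl]

lemma tubeSeries_eq : tubeSeries s =
    X * (1 + tubeSeries s) * (C s * (1 + tubeSeries s) + tubeSeries s) := by
  let p : PowerSeries R := mk fun m => if m = 0 then 0 else properPathSum s m
  let F : PowerSeries R := mk (pathSum s)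
  have hb : tubeSeries s = C s * p := by
    ext m
    rw [coeff_C_mul, tubeSeries, coeff_mk, coeff_mk]
    split_ifs <;> simp
  have hF : F = 1 + (1 + C s) * p := by
    ext m
    rw [add_mul, one_mul, map_add, map_add, coeff_C_mul, coeff_one, coeff_mk, coeff_mk]
    rcases Nat.eq_zero_or_pos m with rfl | hm
    · simp [pathSum_zero]
    · rw [if_neg hm.ne', if_neg hm.ne', pathSum_eq s hm]
      ring
  have hp : p = X * (F * (1 + C s * p)) := by
    ext m
    rcases m with _ | N
    · rw [coeff_zero_X_mul, coeff_mk, if_pos rfl]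
    · rw [coeff_succ_X_mul, coeff_mk, if_neg N.succ_ne_zero, properPathSum_succ]
      have : F * (1 + C s * p) = F + C s * (p * F) := by ring
      rw [this, map_add, coeff_C_mul, coeff_mk, coeff_mul,
        Finset.Nat.sum_antidiagonal_eq_sum_range_succ_mk]
      congr 2
      refine Finset.sum_subset_zero_on_sdiff ?_ ?_ ?_
      · intro j hj
        rw [Finset.mem_Icc] at hj
        rw [Finset.mem_range]
        omega
      · intro j hj
        rw [Finset.mem_sdiff, Finset.mem_Icc, Finset.mem_range] at hj
        have : j = 0 := by omega
        simp [p, this]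
      · intro j hj
        rw [Finset.mem_Icc] at hj
        simp only [p, F, coeff_mk]
        rw [if_neg (by omega)]
  rw [hb]
  linear_combination C s * hp + X * (1 + C s * p) * C s * hF

lemma signedPathSeries_eq (l r : Option Bool) : signedPathSeries s l r =
    1 + X * signedPathSeries s none r +
      ∑ e ∈ Finset.univ.filter (fun e => l ≠ some e), tubeSeries s * afterTubeSeries s e r := by
  ext m
  rcases m with _ | N
  · rw [map_add, map_add, map_sum, coeff_zero_X_mul, Finset.sum_eq_zero]
    · simp [signedPathSeries, signedPathSum_zero]
    · intro e _
      rw [coeff_zero_eq_constantCoeff_apply, map_mul, constantCoeff_tubeSeries, zero_mul]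
  · rw [map_add, map_add, map_sum, coeff_succ_X_mul, signedPathSeries, signedPathSeries, coeff_mk,
      coeff_mk, signedPathSum_succ, coeff_one, if_neg N.succ_ne_zero, zero_add, Finset.mul_sum]
    congr 1
    refine Finset.sum_congr rfl fun e _ => ?_
    rw [coeff_mul, Finset.Nat.sum_antidiagonal_eq_sum_range_succ_mk, Finset.mul_sum]
    refine Finset.sum_subset_zero_on_sdiff ?_ ?_ ?_
    · intro j hj
      rw [Finset.mem_filter, Finset.mem_Icc] at hj
      rw [Finset.mem_range]
      omega
    · intro j hj
      rw [Finset.mem_sdiff, Finset.mem_filter, Finset.mem_Icc, Finset.mem_range] at hj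
      simp only [tubeSeries, afterTubeSeries, coeff_mk]
      rcases Nat.eq_zero_or_pos j with rfl | hj0
      · simp
      · have h : j = N + 1 ∧ r = some e := by
          by_contra hcon
          refine hj.2 ⟨by omega, fun h1 h2 => hcon ⟨h1, h2⟩⟩
        rw [if_pos (⟨by omega, h.2⟩ : N + 1 - j = 0 ∧ r = some e), mul_zero]
    · intro j hj
      rw [Finset.mem_filter, Finset.mem_Icc] at hj
      simp only [tubeSeries, afterTubeSeries, coeff_mk]
      rw [if_neg (by omega), if_neg, mul_assoc]
      rintro ⟨h1, h2⟩
      exact hj.2 (by omega) h2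

lemma afterTubeSeries_of_ne {e : Bool} {r : Option Bool} (h : r ≠ some e) :
    afterTubeSeries s e r = signedPathSeries s (some e) r := by
  ext m
  rw [afterTubeSeries, signedPathSeries, coeff_mk, coeff_mk, if_neg fun h' => h h'.2]

lemma afterTubeSeries_same (e : Bool) :
    afterTubeSeries s e (some e) = signedPathSeries s (some e) (some e) - 1 := by
  ext m
  rw [afterTubeSeries, signedPathSeries, map_sub, coeff_mk, coeff_mk, coeff_one]
  rcases Nat.eq_zero_or_pos m with rfl | hm
  · simp [signedPathSum_zero]
  · rw [if_neg fun h => hm.ne' h.1, if_neg hm.ne', sub_zero]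

/-- The series `1 - b - x - b x`, where `b` is `tubeSeries`. -/
def pathDenominator : PowerSeries R :=
  1 - tubeSeries s - X - X * tubeSeries s

lemma filter_none_ne : Finset.univ.filter (fun e : Bool => (none : Option Bool) ≠ some e) =
    {false, true} := by decide

lemma filter_some_ne (e' : Bool) :
    Finset.univ.filter (fun e : Bool => some e' ≠ some e) = {!e'} := by
  revert e'
  decide

/-- The generating function without restrictions at the ends is `(1 + b) / (1 - b - x - b x)`. -/
lemma signedPathSeries_free :
    signedPathSeries s none none * pathDenominator s = 1 + tubeSeries s := by
  have h0 := signedPathSeries_eq s none none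
  have h1 := signedPathSeries_eq s (some false) none
  have h2 := signedPathSeries_eq s (some true) none
  rw [filter_none_ne, Finset.sum_pair (by decide), afterTubeSeries_of_ne s (by simp),
    afterTubeSeries_of_ne s (by simp)] at h0
  rw [filter_some_ne, Finset.sum_singleton, afterTubeSeries_of_ne s (by simp)] at h1 h2
  simp only [Bool.not_false, Bool.not_true] at h1 h2
  rw [pathDenominator]
  linear_combination (1 - tubeSeries s) * h0 + tubeSeries s * (h1 + h2)

variable [IsDomain R]

lemma ne_zero_of_constantCoeff {f : PowerSeries R} (h : constantCoeff f = 1) : f ≠ 0 := by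
  rintro rfl
  simp at h

/-- The generating function of what may stand between a tube and its antipode is
`1 / ((1 - b - x - b x) (1 + b))`. -/
lemma signedPathSeries_between :
    signedPathSeries s (some false) (some true) * (1 + tubeSeries s) * pathDenominator s = 1 := by
  have h0 := signedPathSeries_eq s none (some true)
  have h1 := signedPathSeries_eq s (some false) (some true)
  have h2 := signedPathSeries_eq s (some true) (some true)
  rw [filter_none_ne, Finset.sum_pair (by decide), afterTubeSeries_of_ne s (by simp),
    afterTubeSeries_same] at h0
  rw [filter_some_ne, Finset.sum_singleton] at h1 h2
  simp only [Bool.not_false, Bool.not_true] at h1 h2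
  rw [afterTubeSeries_same] at h1
  rw [afterTubeSeries_of_ne s (by simp)] at h2
  have hne : (1 : PowerSeries R) - tubeSeries s ≠ 0 :=
    ne_zero_of_constantCoeff (by rw [map_sub, constantCoeff_tubeSeries, map_one, sub_zero])
  generalize signedPathSeries s none (some true) = Z at h0 h1 h2
  generalize signedPathSeries s (some false) (some true) = Rf at h0 h1 h2 ⊢
  generalize signedPathSeries s (some true) (some true) = Rt at h0 h1 h2
  have hZ : Z * pathDenominator s = 1 := by
    rw [pathDenominator]
    linear_combination (1 - tubeSeries s) * h0 + tubeSeries s * (h1 + h2)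
  have hR : Rf * (1 - tubeSeries s) * (1 + tubeSeries s) =
      1 + X * Z * (1 + tubeSeries s) := by
    linear_combination h1 + tubeSeries s * h2
  apply mul_left_cancel₀ hne
  calc (1 - tubeSeries s) * (Rf * (1 + tubeSeries s) * pathDenominator s)
      = pathDenominator s + X * (1 + tubeSeries s) * (Z * pathDenominator s) := by
        linear_combination pathDenominator s * hR
    _ = (1 - tubeSeries s) * 1 := by
        rw [hZ, pathDenominator]
        ring

/-- With `b` the algebraic function `tubeSeries`, the series `1 + x L + 2 x b' R` is rational;
here `L = (1 + b) / D` and `R = 1 / (D (1 + b))` with `D = 1 - b - x - b x`. The reason is that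
`q = D / (1 + b)` is a square root of `E = (1 - x)² - 4 s x`, and the series in question is
`1 - x q' / q = 1 - x E' / (2 E)`. -/
lemma rational_of_tubeSeries :
    (1 + X * signedPathSeries s none none +
        2 * X * derivative R (tubeSeries s) * signedPathSeries s (some false) (some true)) *
      ((1 - X) ^ 2 - 4 * C s * X) = 1 - X - 2 * C s * X := by
  have hb := tubeSeries_eq s
  have hb' := congrArg (derivative R) hb
  have hL := signedPathSeries_free s
  have hR := signedPathSeries_between s
  have hY : (1 : PowerSeries R) + tubeSeries s ≠ 0 :=
    ne_zero_of_constantCoeff (by rw [map_add, constantCoeff_tubeSeries, map_one, add_zero])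
  have hdC : derivative R (C s) = 0 := derivative_C
  have hdX : derivative R (X : PowerSeries R) = 1 := derivative_X
  simp only [Derivation.leibniz, map_add, hdC, hdX, smul_eq_mul, Derivation.map_one_eq_zero] at hb'
  generalize signedPathSeries s none none = L at hL ⊢
  generalize signedPathSeries s (some false) (some true) = Rf at hR ⊢
  obtain ⟨D, hD⟩ : ∃ D, D = pathDenominator s := ⟨_, rfl⟩
  rw [← hD] at hL hR
  rw [pathDenominator] at hD
  generalize derivative R (tubeSeries s) = b' at hb' ⊢
  generalize tubeSeries s = b at hb hb' hL hR hY hD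
  have hDb' : D * b' = (1 + b) ^ 2 * (C s * (1 + b) + b) := by
    rw [hD]
    linear_combination (1 + b) * hb' - 2 * b' * hb
  have hD2 : D ^ 2 = (1 + b) ^ 2 * ((1 - X) ^ 2 - 4 * C s * X) := by
    rw [hD]
    linear_combination (-4) * hb
  apply mul_left_cancel₀ (pow_ne_zero 3 hY)
  have hgD : (1 + X * L + 2 * X * b' * Rf) * ((1 + b) * D) =
      (1 + b) * D + X * (1 + b) ^ 2 + 2 * X * b' := by
    linear_combination X * (1 + b) * hL + 2 * X * b' * hR
  calc (1 + b) ^ 3 * ((1 + X * L + 2 * X * b' * Rf) * ((1 - X) ^ 2 - 4 * C s * X))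
      = (1 + X * L + 2 * X * b' * Rf) * ((1 + b) * D) * D := by
        linear_combination (-(1 + b)) * (1 + X * L + 2 * X * b' * Rf) * hD2
    _ = (1 + b) * D ^ 2 + X * (1 + b) ^ 2 * D + 2 * X * (D * b') := by
        rw [hgD]
        ring
    _ = (1 + b) ^ 3 * (1 - X - 2 * C s * X) := by
        rw [hDb', hD2, hD]
        ring

end PowerSeries

/-! ### Maximal tubings -/

/-- A nonempty set of vertices induces a connected graph if and only if it has no nonempty proper
subset without edges to the rest. -/
lemma SimpleGraph.connected_induce_iff_forall_closed {V : Type*} {H : SimpleGraph V} {A : Set V} :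
    (H.induce A).Connected ↔ A.Nonempty ∧ ∀ B ⊆ A, B.Nonempty →
      (∀ x ∈ B, ∀ y ∈ A, H.Adj x y → y ∈ B) → B = A := by
  constructor
  · intro h
    refine ⟨Set.nonempty_coe_sort.1 h.nonempty, fun B hBA ⟨x, hx⟩ hclosed => ?_⟩
    refine Set.Subset.antisymm hBA fun y hy => ?_
    by_contra hyB
    obtain ⟨p⟩ := h.preconnected ⟨x, hBA hx⟩ ⟨y, hy⟩
    obtain ⟨d, _, hd1, hd2⟩ := p.exists_boundary_dart {z | z.1 ∈ B} hx hyB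
    exact hd2 (hclosed _ hd1 _ d.snd.2 d.adj)
  · rintro ⟨⟨x, hx⟩, h⟩
    rw [SimpleGraph.connected_iff_exists_forall_reachable]
    refine ⟨⟨x, hx⟩, fun ⟨y, hy⟩ => ?_⟩
    have hB := h {y | ∃ hy : y ∈ A, (H.induce A).Reachable ⟨x, hx⟩ ⟨y, hy⟩} (fun y hy => hy.1)
      ⟨x, hx, SimpleGraph.Reachable.rfl⟩ (by
        rintro y ⟨hy, hxy⟩ z hz hyz
        refine ⟨hz, hxy.trans (SimpleGraph.Adj.reachable ?_)⟩
        exact hyz)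
    exact (hB.ge hy).2

namespace DeltaGraph

variable {S : Type*} [DecidableEq S] {Δ : FaceComplex S} {G : DeltaGraph Δ}

lemma IsTube.nonempty {t : Finset S} (ht : G.IsTube t) : t.Nonempty := by
  obtain ⟨x, hx⟩ := (SimpleGraph.connected_induce_iff_forall_closed.1 ht.2).1
  exact ⟨x, hx⟩

lemma IsTube.eq_of_closed {t B : Finset S} (ht : G.IsTube t) (hB : B ⊆ t) (hne : B.Nonempty)
    (hclosed : ∀ x ∈ B, ∀ y ∈ t, G.graph.Adj x y → y ∈ B) : B = t :=
  Finset.coe_injective ((SimpleGraph.connected_induce_iff_forall_closed.1 ht.2).2 B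
    (Finset.coe_subset.2 hB) (Finset.coe_nonempty.2 hne) hclosed)

lemma isTube_of_closed {t : Finset S} (ht : t ∈ Δ.faces) (hne : t.Nonempty)
    (h : ∀ B ⊆ t, B.Nonempty → (∀ x ∈ B, ∀ y ∈ t, G.graph.Adj x y → y ∈ B) → B = t) :
    G.IsTube t := by
  refine ⟨ht, SimpleGraph.connected_induce_iff_forall_closed.2
    ⟨Finset.coe_nonempty.2 hne, fun B hB hBne hclosed => ?_⟩⟩
  have hfin : B.Finite := t.finite_toSet.subset hB
  lift B to Finset S using hfin
  exact congrArg _ (h B (Finset.coe_subset.1 hB) (Finset.coe_nonempty.1 hBne) hclosed)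

/-- Adjacent or intersecting weakly compatible tubes are nested. -/
lemma WeaklyCompatible.nested {t u : Finset S} (h : G.WeaklyCompatible t u)
    (hmeet : ∃ a ∈ t, ∃ b ∈ u, a = b ∨ G.graph.Adj a b) : t ⊆ u ∨ u ⊆ t := by
  rcases h with h | h | ⟨hd, hadj⟩
  · exact Or.inl h
  · exact Or.inr h
  · obtain ⟨a, ha, b, hb, rfl | hab⟩ := hmeet
    · exact absurd hb (Finset.disjoint_left.1 hd ha)
    · exact absurd hab (hadj a ha b hb)

variable {T : Finset {t : Finset S // G.IsTube t}}

/-- The union of `{i}` and of all members of `T` that do not contain `i` but are adjacent to it. -/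
def hull (T : Finset {t : Finset S // G.IsTube t}) (i : S) : Finset S :=
  haveI : DecidablePred fun u : {t : Finset S // G.IsTube t} =>
    i ∉ u.1 ∧ ∃ a ∈ u.1, G.graph.Adj i a := Classical.decPred _
  insert i ((T.filter fun u => i ∉ u.1 ∧ ∃ a ∈ u.1, G.graph.Adj i a).biUnion Subtype.val)

lemma mem_hull {i x : S} : x ∈ hull T i ↔
    x = i ∨ ∃ u ∈ T, (i ∉ u.1 ∧ ∃ a ∈ u.1, G.graph.Adj i a) ∧ x ∈ u.1 := by
  simp only [hull, Finset.mem_insert, Finset.mem_biUnion, Finset.mem_filter, and_assoc]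

lemma self_mem_hull (i : S) : i ∈ hull T i := mem_hull.2 (Or.inl rfl)

lemma subset_hull {i a : S} {u : {t : Finset S // G.IsTube t}} (hu : u ∈ T) (hi : i ∉ u.1)
    (ha : a ∈ u.1) (hia : G.graph.Adj i a) : u.1 ⊆ hull T i :=
  fun _ hx => mem_hull.2 (Or.inr ⟨u, hu, ⟨hi, a, ha, hia⟩, hx⟩)

/-- A member of a tubing containing `i` contains the hull of `i`. -/
lemma hull_subset (hT : G.IsTubing T) {i : S} {w : {t : Finset S // G.IsTube t}} (hw : w ∈ T)
    (hi : i ∈ w.1) : hull T i ⊆ w.1 := by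
  intro x hx
  rcases mem_hull.1 hx with rfl | ⟨u, hu, ⟨hiu, a, ha, hia⟩, hxu⟩
  · exact hi
  · rcases (hT.1 w hw u hu).nested ⟨i, hi, a, ha, Or.inr hia⟩ with h | h
    · exact absurd (h hi) hiu
    · exact h hxu

lemma hull_subset_insert (i : S) : hull T i ⊆ insert i (T.biUnion Subtype.val) := by
  intro x hx
  rcases mem_hull.1 hx with rfl | ⟨u, hu, -, hxu⟩
  · exact Finset.mem_insert_self _ _
  · exact Finset.mem_insert_of_mem (Finset.mem_biUnion.2 ⟨u, hu, hxu⟩)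

lemma isTube_hull {i : S} (hi : insert i (T.biUnion Subtype.val) ∈ Δ.faces) :
    G.IsTube (hull T i) := by
  refine isTube_of_closed (Δ.down_closed hi (hull_subset_insert i)) ⟨i, self_mem_hull i⟩ ?_
  intro B hB hne hclosed
  have hblock : ∀ u ∈ T, i ∉ u.1 → (∃ a ∈ u.1, G.graph.Adj i a) → (B ∩ u.1).Nonempty →
      u.1 ⊆ B := by
    rintro u hu hiu ⟨a, ha, hia⟩ hBu
    have := u.2.eq_of_closed Finset.inter_subset_right hBu (fun x hx y hy hxy =>
      Finset.mem_inter.2 ⟨hclosed x (Finset.mem_inter.1 hx).1 y (subset_hull hu hiu ha hia hy) hxy,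
        hy⟩)
    exact Finset.inter_eq_right.1 this
  have hiB : i ∈ B := by
    obtain ⟨x, hx⟩ := hne
    rcases mem_hull.1 (hB hx) with rfl | ⟨u, hu, ⟨hiu, a, ha, hia⟩, hxu⟩
    · exact hx
    · exact hclosed a (hblock u hu hiu ⟨a, ha, hia⟩ ⟨x, Finset.mem_inter.2 ⟨hx, hxu⟩⟩ ha) i
        (self_mem_hull i) hia.symm
  refine Finset.Subset.antisymm hB fun x hx => ?_
  rcases mem_hull.1 hx with rfl | ⟨u, hu, ⟨hiu, a, ha, hia⟩, hxu⟩
  · exact hiB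
  · have haB := hclosed i hiB a (subset_hull hu hiu ha hia ha) hia
    exact hblock u hu hiu ⟨a, ha, hia⟩ ⟨a, Finset.mem_inter.2 ⟨haB, ha⟩⟩ hxu

/-- The hull of `i` is weakly compatible with all members of a tubing. -/
lemma weaklyCompatible_hull (hT : G.IsTubing T) {i : S} {w : {t : Finset S // G.IsTube t}}
    (hw : w ∈ T) : G.WeaklyCompatible (hull T i) w.1 := by
  by_cases hi : i ∈ w.1
  · exact Or.inl (hull_subset hT hw hi)
  by_cases hadj : ∃ a ∈ w.1, G.graph.Adj i a
  · obtain ⟨a, ha, hia⟩ := hadj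
    exact Or.inr (Or.inl (subset_hull hw hi ha hia))
  by_cases hsub : w.1 ⊆ hull T i
  · exact Or.inr (Or.inl hsub)
  push Not at hadj
  have hfar : ∀ x ∈ hull T i, ∀ y ∈ w.1, ¬(x = y ∨ G.graph.Adj x y) := by
    rintro x hx y hy hxy
    rcases mem_hull.1 hx with rfl | ⟨u, hu, ⟨hiu, a, ha, hia⟩, hxu⟩
    · rcases hxy with rfl | hxy
      · exact hi hy
      · exact hadj y hy hxy
    · rcases (hT.1 u hu w hw).nested ⟨x, hxu, y, hy, hxy⟩ with h | h
      · exact hadj a (h ha) hia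
      · exact hsub (h.trans (subset_hull hu hiu ha hia))
  refine Or.inr (Or.inr ⟨Finset.disjoint_left.2 fun x hx hxw => ?_, fun x hx y hy hxy => ?_⟩)
  · exact hfar x hx x hxw (Or.inl rfl)
  · exact hfar x hx y hy (Or.inr hxy)

lemma WeaklyCompatible.symm {t u : Finset S} (h : G.WeaklyCompatible t u) :
    G.WeaklyCompatible u t := by
  rcases h with h | h | ⟨hd, hadj⟩
  · exact Or.inr (Or.inl h)
  · exact Or.inl h
  · exact Or.inr (Or.inr ⟨hd.symm, fun a ha b hb hab => hadj b hb a ha hab.symm⟩)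

/-- A maximal tubing contains the hulls of all vertices by which its union can be enlarged. -/
lemma IsMaximalTubing.hull_mem (hT : G.IsMaximalTubing T) {i : S}
    (hi : insert i (T.biUnion Subtype.val) ∈ Δ.faces) :
    (⟨hull T i, isTube_hull hi⟩ : {t : Finset S // G.IsTube t}) ∈ T := by
  have htub : G.IsTubing (insert ⟨hull T i, isTube_hull hi⟩ T) := by
    refine ⟨fun t ht u hu => ?_, ?_⟩
    · rcases Finset.mem_insert.1 ht with rfl | ht <;> rcases Finset.mem_insert.1 hu with rfl | hu
      · exact Or.inl (Finset.Subset.refl _)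
      · exact weaklyCompatible_hull hT.1 hu
      · exact (weaklyCompatible_hull hT.1 ht).symm
      · exact hT.1.1 t ht u hu
    · refine Δ.down_closed hi ?_
      rw [Finset.biUnion_insert]
      exact Finset.union_subset (hull_subset_insert i) (Finset.subset_insert _ _)
  exact hT.2 htub (Finset.subset_insert _ _) (Finset.mem_insert_self _ _)

/-- Every member of a tubing has a vertex outside of all smaller members: a maximal smaller member
is joined by an edge to a vertex outside of it, which no smaller member can contain. -/
lemma IsTubing.exists_mem_forall_notMem (hT : G.IsTubing T) (t : {t : Finset S // G.IsTube t}) :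
    ∃ i ∈ t.1, ∀ u ∈ T, u.1 ⊂ t.1 → i ∉ u.1 := by
  classical
  by_cases hne : (T.filter fun u => u.1 ⊂ t.1).Nonempty
  · obtain ⟨u, hu, hmax⟩ := Finset.exists_max_image _ (fun u => u.1.card) hne
    rw [Finset.mem_filter] at hu
    have hex : ∃ x ∈ u.1, ∃ y ∈ t.1, G.graph.Adj x y ∧ y ∉ u.1 := by
      by_contra! hno
      exact hu.2.ne (t.2.eq_of_closed hu.2.subset u.2.nonempty fun x hx y hy hxy => hno x hx y hy hxy)
    obtain ⟨x, hx, y, hy, hxy, hyu⟩ := hex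
    refine ⟨y, hy, fun w hw hwt hyw => ?_⟩
    rcases (hT.1 u hu.1 w hw).nested ⟨x, hx, y, hyw, Or.inr hxy⟩ with h | h
    · have := hmax w (Finset.mem_filter.2 ⟨hw, hwt⟩)
      have heq := Finset.eq_of_subset_of_card_le h this
      exact hyu (heq ▸ hyw)
    · exact hyu (h hyw)
  · obtain ⟨i, hi⟩ := t.2.nonempty
    exact ⟨i, hi, fun u hu hut => absurd ⟨u, Finset.mem_filter.2 ⟨hu, hut⟩⟩ hne⟩

lemma IsMaximalTubing.mem_biUnion (hT : G.IsMaximalTubing T) {i : S}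
    (hi : insert i (T.biUnion Subtype.val) ∈ Δ.faces) : i ∈ T.biUnion Subtype.val :=
  Finset.mem_biUnion.2 ⟨_, hT.hull_mem hi, self_mem_hull i⟩

/-- A maximal tubing has as many tubes as its union has vertices, because every tube is the hull of
exactly one vertex. -/
lemma IsMaximalTubing.card_eq (hT : G.IsMaximalTubing T) :
    T.card = (T.biUnion Subtype.val).card := by
  classical
  have hface : ∀ i ∈ T.biUnion Subtype.val, insert i (T.biUnion Subtype.val) ∈ Δ.faces :=
    fun i hi => by rw [Finset.insert_eq_self.2 hi]; exact hT.1.2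
  have himage : T.image Subtype.val = (T.biUnion Subtype.val).image (hull T) := by
    ext A
    simp only [Finset.mem_image]
    constructor
    · rintro ⟨t, ht, rfl⟩
      obtain ⟨i, hi, hnot⟩ := hT.1.exists_mem_forall_notMem t
      have hiU := Finset.mem_biUnion.2 ⟨t, ht, hi⟩
      refine ⟨i, hiU, ?_⟩
      by_contra hne
      exact hnot _ (hT.hull_mem (hface i hiU))
        (Finset.ssubset_iff_subset_ne.2 ⟨hull_subset hT.1 ht hi, hne⟩) (self_mem_hull i)
    · rintro ⟨i, hi, rfl⟩
      exact ⟨_, hT.hull_mem (hface i hi), rfl⟩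
  have hinj : Set.InjOn (hull T) (T.biUnion Subtype.val) := by
    intro i hi j hj hij
    by_contra hne
    have hji : j ∈ hull T i := hij ▸ self_mem_hull j
    rcases mem_hull.1 hji with h | ⟨u, hu, ⟨hiu, -⟩, hju⟩
    · exact hne h.symm
    · exact hiu (hull_subset hT.1 hu hju (hij ▸ self_mem_hull i))
  rw [← Finset.card_image_of_injective T Subtype.val_injective, himage,
    Finset.card_image_of_injOn hinj]

end DeltaGraph

/-! ### Coordinates on the twisted cycle and its tubes -/

instance finite_plusMinus (n : ℕ) : Finite (PlusMinus n) := by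
  refine Set.Finite.subset (Set.finite_Icc (-(n : ℤ)) n) fun i hi => ?_
  exact abs_le.1 hi.2

/-- A numbering of the vertices of the twisted cycle by `0, …, 2 * n - 1` along the cycle. -/
structure CycleCoord (n : ℕ) where
  toFun : PlusMinus n → ℕ
  lt : ∀ x, toFun x < 2 * n
  injective : Function.Injective toFun
  exists_eq : ∀ k, k < 2 * n → ∃ x, toFun x = k
  neg_iff : ∀ x y : PlusMinus n, (y : ℤ) = -(x : ℤ) ↔ toFun y = toFun x + n ∨ toFun x = toFun y + n
  adj_iff : ∀ x y, (twistedCycle n).graph.Adj x y ↔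
    (toFun y = toFun x + 1 ∨ toFun x = toFun y + 1 ∨ (toFun x = 0 ∧ toFun y + 1 = 2 * n) ∨
      (toFun y = 0 ∧ toFun x + 1 = 2 * n)) ∧ ¬(toFun y = toFun x + n ∨ toFun x = toFun y + n)

namespace CycleCoord

variable {n : ℕ}

/-- The numbering along `1, …, n, -1, …, -n`. -/
def standard (n : ℕ) : CycleCoord n where
  toFun x := (if 0 < (x : ℤ) then (x : ℤ) - 1 else n - 1 - x).toNat
  lt x := by
    obtain ⟨x, h0, h1⟩ := x
    rw [abs_le] at h1
    simp only
    split_ifs <;> omega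
  injective x y h := by
    obtain ⟨x, h0, h1⟩ := x
    obtain ⟨y, h2, h3⟩ := y
    rw [abs_le] at h1 h3
    simp only at h
    rw [Subtype.mk.injEq]
    split_ifs at h <;> omega
  exists_eq k hk := by
    by_cases hkn : k < n
    · exact ⟨⟨k + 1, by omega, abs_le.2 (by omega)⟩, by simp only; split_ifs <;> omega⟩
    · exact ⟨⟨n - 1 - k, by omega, abs_le.2 (by omega)⟩, by simp only; split_ifs <;> omega⟩
  neg_iff x y := by
    obtain ⟨x, h0, h1⟩ := x
    obtain ⟨y, h2, h3⟩ := y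
    rw [abs_le] at h1 h3
    simp only
    split_ifs <;> omega
  adj_iff x y := by
    obtain ⟨x, h0, h1⟩ := x
    obtain ⟨y, h2, h3⟩ := y
    rw [abs_le] at h1 h3
    simp only [twistedCycle, SimpleGraph.fromRel_adj, TwistedCycleSucc, ne_eq, Subtype.mk.injEq]
    split_ifs <;> omega

/-- The numbering started at the vertex of number `i`. -/
def rebase (c : CycleCoord n) (i : ℕ) (hi : i < 2 * n) : CycleCoord n where
  toFun x := if i ≤ c.toFun x then c.toFun x - i else c.toFun x + 2 * n - i
  lt x := by
    have := c.lt x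
    split_ifs <;> omega
  injective x y h := by
    apply c.injective
    have := c.lt x
    have := c.lt y
    simp only at h
    split_ifs at h <;> omega
  exists_eq k hk := by
    by_cases h : k + i < 2 * n
    · obtain ⟨x, hx⟩ := c.exists_eq (k + i) h
      exact ⟨x, by split_ifs <;> omega⟩
    · obtain ⟨x, hx⟩ := c.exists_eq (k + i - 2 * n) (by omega)
      exact ⟨x, by split_ifs <;> omega⟩
  neg_iff x y := by
    have := c.lt x
    have := c.lt y
    rw [c.neg_iff]
    split_ifs <;> omega
  adj_iff x y := by
    have := c.lt x
    have := c.lt y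
    rw [c.adj_iff]
    split_ifs <;> omega

/-- The vertices with numbers in `[i, j)`. -/
def arc (c : CycleCoord n) (i j : ℕ) : Finset (PlusMinus n) :=
  (Set.toFinite {x | i ≤ c.toFun x ∧ c.toFun x < j}).toFinset

lemma mem_arc {c : CycleCoord n} {i j : ℕ} {x : PlusMinus n} :
    x ∈ c.arc i j ↔ i ≤ c.toFun x ∧ c.toFun x < j := by
  simp [arc]

variable (c : CycleCoord n)

lemma card_arc {i j : ℕ} (hj : j ≤ 2 * n) : (c.arc i j).card = j - i := by
  rw [← Nat.card_Ico, ← Finset.card_image_of_injective _ c.injective]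
  congr 1
  ext k
  simp only [Finset.mem_image, mem_arc, Finset.mem_Ico]
  constructor
  · rintro ⟨x, hx, rfl⟩
    exact hx
  · intro hk
    obtain ⟨x, rfl⟩ := c.exists_eq k (by omega)
    exact ⟨x, hk, rfl⟩

lemma arc_subset_arc {i j k l : ℕ} (hij : i < j) (hj : j ≤ 2 * n) :
    c.arc i j ⊆ c.arc k l ↔ k ≤ i ∧ j ≤ l := by
  constructor
  · intro h
    obtain ⟨x, hx⟩ := c.exists_eq i (by omega)
    obtain ⟨y, hy⟩ := c.exists_eq (j - 1) (by omega)
    have h1 := mem_arc.1 (h (mem_arc.2 (by omega) : x ∈ _))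
    have h2 := mem_arc.1 (h (mem_arc.2 (by omega) : y ∈ _))
    omega
  · intro h x hx
    rw [mem_arc] at hx ⊢
    omega

lemma arc_eq_arc {i j k l : ℕ} (hij : i < j) (hj : j ≤ 2 * n) (hkl : k < l) (hl : l ≤ 2 * n) :
    c.arc i j = c.arc k l ↔ i = k ∧ j = l := by
  rw [Finset.Subset.antisymm_iff, c.arc_subset_arc hij hj, c.arc_subset_arc hkl hl]
  omega

lemma mem_faces_iff {A : Finset (PlusMinus n)} : A ∈ (hypercubeComplex n).faces ↔
    ∀ x ∈ A, ∀ y ∈ A, c.toFun y ≠ c.toFun x + n := by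
  constructor
  · exact fun h x hx y hy hxy => h x hx y hy ((c.neg_iff x y).2 (Or.inl hxy))
  · intro h x hx y hy hxy
    rcases (c.neg_iff x y).1 hxy with h1 | h1
    · exact h x hx y hy h1
    · exact h y hy x hx h1

lemma isTube_arc {i j : ℕ} (hij : i < j) (hj : j ≤ 2 * n) (hjn : j ≤ i + n) :
    (twistedCycle n).IsTube (c.arc i j) := by
  refine DeltaGraph.isTube_of_closed ?_ ?_ ?_
  · rw [c.mem_faces_iff]
    intro x hx y hy
    rw [mem_arc] at hx hy
    omega
  · obtain ⟨x, hx⟩ := c.exists_eq i (by omega)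
    exact ⟨x, mem_arc.2 (by omega)⟩
  · intro B hB ⟨x, hx⟩ hclosed
    refine Finset.Subset.antisymm hB fun y hy => ?_
    have hxa := mem_arc.1 (hB hx)
    have hup : ∀ d y, c.toFun y = c.toFun x + d → y ∈ c.arc i j → y ∈ B := by
      intro d
      induction d with
      | zero =>
        intro y hy _
        rwa [c.injective (hy.trans (Nat.add_zero _))]
      | succ d ih =>
        intro y hy hya
        rw [mem_arc] at hya
        obtain ⟨z, hz⟩ := c.exists_eq (c.toFun x + d) (by omega)
        refine hclosed z (ih z hz (mem_arc.2 (by omega))) y (mem_arc.2 hya) ((c.adj_iff z y).2 ?_)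
        omega
    have hdown : ∀ d y, c.toFun y + d = c.toFun x → y ∈ c.arc i j → y ∈ B := by
      intro d
      induction d with
      | zero =>
        intro y hy _
        rwa [c.injective ((Nat.add_zero _).symm.trans hy)]
      | succ d ih =>
        intro y hy hya
        rw [mem_arc] at hya
        obtain ⟨z, hz⟩ := c.exists_eq (c.toFun y + 1) (by omega)
        refine hclosed z (ih z (by omega) (mem_arc.2 (by omega))) y (mem_arc.2 hya)
          ((c.adj_iff z y).2 ?_)
        omega
    rcases le_total (c.toFun x) (c.toFun y) with h | h
    · exact hup (c.toFun y - c.toFun x) y (by omega) hy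
    · exact hdown (c.toFun x - c.toFun y) y (by omega) hy

/-- A tube that does not contain both the first and the last vertex is an arc: its vertices below
a missing number would have no edges to those above. -/
lemma exists_eq_arc {t : Finset (PlusMinus n)} (ht : (twistedCycle n).IsTube t)
    (hend : ∀ x ∈ t, ∀ y ∈ t, c.toFun x = 0 → c.toFun y + 1 ≠ 2 * n) :
    ∃ i j, i < j ∧ j ≤ 2 * n ∧ j ≤ i + n ∧ t = c.arc i j := by
  obtain ⟨x, hx, hmin⟩ := Finset.exists_min_image t c.toFun ht.nonempty
  obtain ⟨y, hy, hmax⟩ := Finset.exists_max_image t c.toFun ht.nonempty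
  have hylt := c.lt y
  have hconv : ∀ p, c.toFun x ≤ c.toFun p → c.toFun p ≤ c.toFun y → p ∈ t := by
    intro p hxp hpy
    by_contra hp
    have hne : ∀ q ∈ t, c.toFun q ≠ c.toFun p := fun q hq h => hp (c.injective h ▸ hq)
    have hB := ht.eq_of_closed (B := t.filter fun q => c.toFun q < c.toFun p)
      (Finset.filter_subset _ _)
      ⟨x, Finset.mem_filter.2 ⟨hx, lt_of_le_of_ne hxp (hne x hx)⟩⟩ (by
        intro u hu v hv huv
        rw [Finset.mem_filter] at hu ⊢
        refine ⟨hv, ?_⟩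
        have h1 := hne v hv
        have h2 := hend u hu.1 v hv
        have h3 := hend v hv u hu.1
        have h4 := ((c.adj_iff u v).1 huv).1
        omega)
    have := (Finset.mem_filter.1 (hB.symm ▸ hy : y ∈ t.filter fun q => c.toFun q < c.toFun p)).2
    omega
  refine ⟨c.toFun x, c.toFun y + 1, ?_, by omega, ?_, ?_⟩
  · have := hmin y hy
    omega
  · by_contra hlong
    obtain ⟨p, hp⟩ := c.exists_eq (c.toFun x + n) (by omega)
    exact c.mem_faces_iff.1 ht.1 x hx p (hconv p (by omega) (by omega)) hp
  · ext p
    rw [mem_arc]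
    constructor
    · intro hp
      have := hmin p hp
      have := hmax p hp
      omega
    · exact fun hp => hconv p hp.1 (by omega)

/-- Every tube is an initial arc for a suitable numbering. -/
lemma exists_eq_initial_arc {t : Finset (PlusMinus n)} (ht : (twistedCycle n).IsTube t) :
    ∃ (c : CycleCoord n) (m : ℕ), 1 ≤ m ∧ m ≤ n ∧ t = c.arc 0 m := by
  obtain ⟨x, hx⟩ := ht.nonempty
  have hlt := (standard n).lt x
  -- Start the numbering at the antipode of a vertex of the tube, where the tube cannot wrap around.
  obtain ⟨d, hd, y, hy, hy0⟩ : ∃ d : CycleCoord n, d.toFun x = n ∧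
      ∃ y, d.toFun y = 0 ∧ ∀ z, d.toFun z = 0 → z = y := by
    obtain ⟨k, hk, hkx⟩ : ∃ k, k < 2 * n ∧
        ((standard n).toFun x = k + n ∨ k = (standard n).toFun x + n) := by
      by_cases h : (standard n).toFun x < n
      · exact ⟨(standard n).toFun x + n, by omega, Or.inr rfl⟩
      · exact ⟨(standard n).toFun x - n, by omega, Or.inl (by omega)⟩
    refine ⟨(standard n).rebase k hk, ?_, ?_⟩
    · simp only [rebase]
      split_ifs <;> omega
    · obtain ⟨y, hy⟩ := ((standard n).rebase k hk).exists_eq 0 (by omega)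
      exact ⟨y, hy, fun z hz => ((standard n).rebase k hk).injective (hz.trans hy.symm)⟩
  obtain ⟨i, j, hij, hj, hjn, rfl⟩ := d.exists_eq_arc ht (fun z hz _ _ hz0 _ => by
    rw [hy0 z hz0] at hz
    exact d.mem_faces_iff.1 ht.1 y hz x hx (by omega))
  refine ⟨d.rebase i (by omega), j - i, by omega, by omega, ?_⟩
  ext z
  have := d.lt z
  simp only [mem_arc, rebase]
  split_ifs <;> omega

end CycleCoord

/-- Two tubes of the twisted cycle form a tubing. -/
def TubeCompatible (n : ℕ) (t u : Finset (PlusMinus n)) : Prop :=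
  (twistedCycle n).WeaklyCompatible t u ∧ t ∪ u ∈ (hypercubeComplex n).faces

lemma TubeCompatible.symm {n : ℕ} {t u : Finset (PlusMinus n)} (h : TubeCompatible n t u) :
    TubeCompatible n u t :=
  ⟨DeltaGraph.WeaklyCompatible.symm h.1, Finset.union_comm t u ▸ h.2⟩

namespace CycleCoord

variable {n : ℕ} (c : CycleCoord n)

lemma tubeCompatible_arc {i j k l : ℕ} (hij : i < j) (hj : j ≤ 2 * n) (hjn : j ≤ i + n)
    (hkl : k < l) (hl : l ≤ 2 * n) (hln : l ≤ k + n) :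
    TubeCompatible n (c.arc i j) (c.arc k l) ↔
      ((k ≤ i ∧ j ≤ l) ∨ (i ≤ k ∧ l ≤ j) ∨ (j < k ∧ ¬(i = 0 ∧ l = 2 * n)) ∨
        (l < i ∧ ¬(k = 0 ∧ j = 2 * n))) ∧
      (j + n ≤ k ∨ l ≤ i + n) ∧ (l + n ≤ i ∨ j ≤ k + n) := by
  have hface : c.arc i j ∪ c.arc k l ∈ (hypercubeComplex n).faces ↔
      (j + n ≤ k ∨ l ≤ i + n) ∧ (l + n ≤ i ∨ j ≤ k + n) := by
    rw [c.mem_faces_iff]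
    constructor
    · intro h
      constructor
      · by_contra hcon
        obtain ⟨x, hx⟩ := c.exists_eq (max i (k - n)) (by omega)
        obtain ⟨y, hy⟩ := c.exists_eq (max i (k - n) + n) (by omega)
        exact h x (Finset.mem_union_left _ (mem_arc.2 (by omega))) y
          (Finset.mem_union_right _ (mem_arc.2 (by omega))) (by omega)
      · by_contra hcon
        obtain ⟨x, hx⟩ := c.exists_eq (max k (i - n)) (by omega)
        obtain ⟨y, hy⟩ := c.exists_eq (max k (i - n) + n) (by omega)
        exact h x (Finset.mem_union_right _ (mem_arc.2 (by omega))) y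
          (Finset.mem_union_left _ (mem_arc.2 (by omega))) (by omega)
    · intro h x hx y hy
      rw [Finset.mem_union, mem_arc, mem_arc] at hx hy
      omega
  rw [TubeCompatible, hface, and_congr_left_iff]
  intro hanti
  rw [DeltaGraph.WeaklyCompatible, c.arc_subset_arc hij hj, c.arc_subset_arc hkl hl]
  refine or_congr_right (or_congr_right ?_)
  constructor
  · rintro ⟨hdisj, hadj⟩
    have hdis : j ≤ k ∨ l ≤ i := by
      by_contra hcon
      obtain ⟨x, hx⟩ := c.exists_eq (max i k) (by omega)
      exact Finset.disjoint_left.1 hdisj (mem_arc.2 (by omega) : x ∈ _) (mem_arc.2 (by omega))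
    have hno : ∀ a b, i ≤ a → a < j → k ≤ b → b < l →
        ¬((b = a + 1 ∨ a = b + 1 ∨ (a = 0 ∧ b + 1 = 2 * n) ∨ (b = 0 ∧ a + 1 = 2 * n)) ∧
          ¬(b = a + n ∨ a = b + n)) := by
      intro a b h1 h2 h3 h4
      obtain ⟨x, rfl⟩ := c.exists_eq a (by omega)
      obtain ⟨y, rfl⟩ := c.exists_eq b (by omega)
      rw [← c.adj_iff]
      exact hadj x (mem_arc.2 ⟨h1, h2⟩) y (mem_arc.2 ⟨h3, h4⟩)
    rcases hdis with h | h
    · have h1 := hno (j - 1) k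
      have h2 := hno i (l - 1)
      omega
    · have h1 := hno i (l - 1)
      have h2 := hno (j - 1) k
      omega
  · intro h
    refine ⟨Finset.disjoint_left.2 fun x hx hx' => ?_, fun x hx y hy hxy => ?_⟩
    · rw [mem_arc] at hx hx'
      omega
    · rw [mem_arc] at hx hy
      rw [c.adj_iff] at hxy
      omega

/-- The arc of a signed interval: the numbers are shifted by `k`, and by a further half turn if
the sign is negative. -/
def signedArc (k : ℕ) (u : Bool × ℕ × ℕ) : Finset (PlusMinus n) :=
  c.arc (k + (if u.1 then n else 0) + u.2.1) (k + (if u.1 then n else 0) + u.2.2)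

end CycleCoord

/-! ### Counting tubings of the twisted cycle -/

namespace CycleCoord

variable {n : ℕ} (c : CycleCoord n)

lemma tubeCompatible_signedArc {k : ℕ} (hk : 1 ≤ k) {u w : Bool × ℕ × ℕ} (hu : u.2.1 < u.2.2)
    (hun : u.2.2 + k ≤ n) (hw : w.2.1 < w.2.2) (hwn : w.2.2 + k ≤ n) :
    TubeCompatible n (c.signedArc k u) (c.signedArc k w) ↔ SignedCompatible u w := by
  obtain ⟨e, a, b⟩ := u
  obtain ⟨e', a', b'⟩ := w
  simp only at hu hun hw hwn
  cases e <;> cases e' <;>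
  · simp only [signedArc, SignedCompatible, IntervalCompatible, if_true, Bool.false_eq_true,
      if_false, ne_eq, not_true, false_and, or_false, true_and, reduceCtorEq, not_false_eq_true,
      false_or]
    rw [c.tubeCompatible_arc (by omega) (by omega) (by omega) (by omega) (by omega) (by omega)]
    omega

lemma signedArc_injOn {k : ℕ} {V : Set (Bool × ℕ × ℕ)}
    (hV : ∀ u ∈ V, u.2.1 < u.2.2 ∧ u.2.2 + k ≤ n) : Set.InjOn (c.signedArc k) V := by
  rintro ⟨e, a, b⟩ hu ⟨e', a', b'⟩ hw h
  have h1 := hV _ hu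
  have h2 := hV _ hw
  simp only at h1 h2
  cases e <;> cases e' <;>
  · simp only [signedArc, if_true, Bool.false_eq_true, if_false] at h
    rw [c.arc_eq_arc (by omega) (by omega) (by omega) (by omega)] at h
    simp only [Prod.mk.injEq, reduceCtorEq, true_and, false_and]
    omega

variable {R : Type*} [CommSemiring R] (s : R)

lemma cliqueSum_image_signedArc [DecidableEq (Finset (PlusMinus n))] {k : ℕ} (hk : 1 ≤ k)
    (hkn : k ≤ n) (l r : Option Bool) :
    cliqueSum s ((signedIntervals (n - k) l r).image (c.signedArc k)) (TubeCompatible n) =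
      signedPathSum s l r (n - k) := by
  have hV : ∀ u ∈ signedIntervals (n - k) l r, u.2.1 < u.2.2 ∧ u.2.2 + k ≤ n := by
    intro u hu
    have := (mem_signedIntervals.1 hu).1
    omega
  refine cliqueSum_image s (c.signedArc_injOn hV) fun u hu w hw _ => ?_
  exact c.tubeCompatible_signedArc hk (hV u hu).1 (hV u hu).2 (hV w hw).1 (hV w hw).2

lemma cliqueSum_image_arc [DecidableEq (Finset (PlusMinus n))] {m : ℕ} (hmn : m ≤ n) :
    cliqueSum s ((properIntervals m).image fun u => c.arc u.1 u.2) (TubeCompatible n) =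
      properPathSum s m := by
  refine cliqueSum_image s ?_ ?_
  · intro u hu w hw h
    have h1 := mem_properIntervals.1 (Finset.mem_coe.1 hu)
    have h2 := mem_properIntervals.1 (Finset.mem_coe.1 hw)
    exact Prod.ext_iff.2 ((c.arc_eq_arc h1.1 (by omega) h2.1 (by omega)).1 h)
  · intro u hu w hw _
    have h1 := mem_properIntervals.1 hu
    have h2 := mem_properIntervals.1 hw
    rw [c.tubeCompatible_arc h1.1 (by omega) (by omega) h2.1 (by omega) (by omega),
      IntervalCompatible]
    omega

end CycleCoord

/-- The tubes of the twisted cycle. -/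
def tubes (n : ℕ) : Finset (Finset (PlusMinus n)) :=
  (Set.toFinite {t | (twistedCycle n).IsTube t}).toFinset

lemma mem_tubes {n : ℕ} {t : Finset (PlusMinus n)} : t ∈ tubes n ↔ (twistedCycle n).IsTube t := by
  simp [tubes]

namespace CycleCoord

variable {n : ℕ} (c : CycleCoord n)

/-- There are `m` tubes of `m` vertices through a given vertex, for `1 ≤ m ≤ n`. -/
lemma sum_tubes_through {M : Type*} [AddCommMonoid M] (g : ℕ → M) {x : PlusMinus n}
    (hx : c.toFun x = n) [DecidablePred fun t : Finset (PlusMinus n) => x ∈ t] :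
    ∑ t ∈ (tubes n).filter (fun t => x ∈ t), g t.card = ∑ m ∈ Finset.Icc 1 n, m • g m := by
  classical
  have himage : (tubes n).filter (fun t => x ∈ t) =
      ((Finset.Icc 1 n).sigma fun m => Finset.range m).image
        fun q => c.arc (n - q.2) (n - q.2 + q.1) := by
    ext t
    simp only [Finset.mem_filter, mem_tubes, Finset.mem_image, Finset.mem_sigma, Finset.mem_Icc,
      Finset.mem_range, Sigma.exists]
    constructor
    · rintro ⟨ht, hxt⟩
      obtain ⟨i, j, hij, hj, hjn, rfl⟩ := c.exists_eq_arc ht (fun y hy _ _ hy0 _ =>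
        c.mem_faces_iff.1 ht.1 y hy x hxt (by omega))
      rw [mem_arc] at hxt
      refine ⟨j - i, n - i, ⟨by omega, by omega⟩, ?_⟩
      congr 1 <;> omega
    · rintro ⟨m, i, hmi, rfl⟩
      exact ⟨c.isTube_arc (by omega) (by omega) (by omega), mem_arc.2 (by omega)⟩
  rw [himage, Finset.sum_image, Finset.sum_sigma]
  · refine Finset.sum_congr rfl fun m hm => ?_
    rw [Finset.mem_Icc] at hm
    rw [Finset.sum_congr rfl (g := fun _ => g m), Finset.sum_const, Finset.card_range]
    intro i hi
    rw [Finset.mem_range] at hi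
    simp only
    rw [c.card_arc (by omega)]
    congr 1
    omega
  · rintro ⟨m, i⟩ hmi ⟨m', i'⟩ hmi' h
    simp only [Finset.coe_sigma, Set.mem_sigma_iff, Finset.coe_Icc, Set.mem_Icc, Finset.coe_range,
      Set.mem_Iio] at hmi hmi'
    simp only at h
    rw [c.arc_eq_arc (by omega) (by omega) (by omega) (by omega)] at h
    obtain ⟨rfl, rfl⟩ : m = m' ∧ i = i' := by omega
    rfl

variable {R : Type*} [CommSemiring R] (s : R)

/-- The tubes compatible with a tube `w` that do not contain it properly are the tubes inside of
`w` and those in the two paths between `w` and its antipode. -/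
lemma cliqueSum_link {m : ℕ} (hm : 1 ≤ m) (hmn : m ≤ n) {x y : PlusMinus n}
    (hxy : (y : ℤ) = -(x : ℤ)) (hw : x ∈ c.arc 0 m ∨ y ∈ c.arc 0 m) :
    ∃ U : Finset (Finset (PlusMinus n)), (∀ u, u ∈ U ↔ u ∈ tubes n ∧ u ≠ c.arc 0 m ∧
        TubeCompatible n u (c.arc 0 m) ∧ ¬((x ∈ u ∨ y ∈ u) ∧ m < u.card)) ∧
      cliqueSum s U (TubeCompatible n) =
        properPathSum s m * signedPathSum s (some false) (some true) (n - m) := by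
  classical
  have hxlt := c.lt x
  have hylt := c.lt y
  rw [c.neg_iff] at hxy
  rw [mem_arc, mem_arc] at hw
  have hproper : ∀ u ∈ properIntervals m, u.1 < u.2 ∧ u.2 ≤ m ∧ (u.1 = 0 → u.2 ≠ m) :=
    fun u hu => mem_properIntervals.1 hu
  -- A signed interval in the path of `n - m` vertices gives an arc that is not adjacent to `w`.
  have hsigned : ∀ u ∈ signedIntervals (n - m) (some false) (some true), ∃ i j,
      c.signedArc m u = c.arc i j ∧ i < j ∧ j ≤ i + n ∧
        ((m < i ∧ j ≤ n) ∨ (m + n ≤ i ∧ j < 2 * n)) := by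
    rintro ⟨e, a, b⟩ hu
    obtain ⟨h1, h2, h3⟩ := mem_signedIntervals.1 hu
    simp only at h1 h2 h3
    refine ⟨_, _, rfl, ?_⟩
    cases e
    · have : a ≠ 0 := fun h => h2 h rfl
      simp only [Bool.false_eq_true, if_false]
      omega
    · have : b ≠ n - m := fun h => h3 h rfl
      simp only [if_true]
      omega
  refine ⟨(properIntervals m).image (fun u => c.arc u.1 u.2) ∪
    (signedIntervals (n - m) (some false) (some true)).image (c.signedArc m), fun A => ?_, ?_⟩
  · rw [Finset.mem_union, Finset.mem_image, Finset.mem_image, mem_tubes]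
    constructor
    · rintro (⟨⟨a, b⟩, hu, rfl⟩ | ⟨u, hu, rfl⟩)
      · have h := hproper _ hu
        simp only at h ⊢
        rw [ne_eq, c.arc_eq_arc h.1 (by omega) hm (by omega),
          c.tubeCompatible_arc h.1 (by omega) (by omega) hm (by omega) (by omega),
          c.card_arc (by omega)]
        exact ⟨c.isTube_arc h.1 (by omega) (by omega), by omega, by omega, by omega⟩
      · obtain ⟨i, j, hij, h⟩ := hsigned u hu
        rw [hij, ne_eq, c.arc_eq_arc h.1 (by omega) hm (by omega),
          c.tubeCompatible_arc h.1 (by omega) (by omega) hm (by omega) (by omega), mem_arc, mem_arc]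
        exact ⟨c.isTube_arc h.1 (by omega) (by omega), by omega, by omega, by omega⟩
    · rintro ⟨hA, hne, hrel, hmax⟩
      -- `A` cannot contain `w`, being different from it and not larger.
      have hnot : ¬c.arc 0 m ⊆ A := by
        intro hsub
        have hpA : x ∈ A ∨ y ∈ A :=
          hw.imp (fun h => hsub (mem_arc.2 h)) (fun h => hsub (mem_arc.2 h))
        have hle : A.card ≤ (c.arc 0 m).card := by
          rw [c.card_arc (by omega)]
          by_contra hlt
          exact hmax ⟨hpA, by omega⟩
        exact hne (Finset.eq_of_subset_of_card_le hsub hle).symm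
      obtain ⟨i, j, hij, hj, hjn, rfl⟩ := c.exists_eq_arc hA (by
        intro p hp q hq hp0 hq1
        rcases hrel.1.nested ⟨p, hp, p, mem_arc.2 (by omega), Or.inl rfl⟩ with h | h
        · have := mem_arc.1 (h hq)
          omega
        · exact hnot h)
      rw [c.tubeCompatible_arc hij hj hjn hm (by omega) (by omega)] at hrel
      rw [c.arc_subset_arc hm (by omega)] at hnot
      rw [ne_eq, c.arc_eq_arc hij hj hm (by omega)] at hne
      by_cases hjm : j ≤ m
      · exact Or.inl ⟨(i, j), mem_properIntervals.2 ⟨hij, hjm, by simp only; omega⟩, rfl⟩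
      · right
        by_cases hjn' : j ≤ n
        · refine ⟨(false, i - m, j - m), mem_signedIntervals.2 ⟨by simp only; omega, ?_, ?_⟩, ?_⟩
          · simp only
            omega
          · simp
          · simp only [signedArc, Bool.false_eq_true, if_false]
            congr 1 <;> omega
        · refine ⟨(true, i - m - n, j - m - n), mem_signedIntervals.2 ⟨by simp only; omega, ?_, ?_⟩,
            ?_⟩
          · simp
          · simp only
            omega
          · simp only [signedArc, if_true]
            congr 1 <;> omega
  · rw [cliqueSum_union, c.cliqueSum_image_arc s hmn, c.cliqueSum_image_signedArc s hm hmn]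
    · rw [Finset.disjoint_left]
      intro A hA hA'
      obtain ⟨⟨a, b⟩, hu, rfl⟩ := Finset.mem_image.1 hA
      obtain ⟨u, hu', heq⟩ := Finset.mem_image.1 hA'
      have h := hproper _ hu
      obtain ⟨i, j, hij, h'⟩ := hsigned u hu'
      simp only at h heq
      rw [hij, c.arc_eq_arc h'.1 (by omega) h.1 (by omega)] at heq
      omega
    · intro A hA A' hA'
      obtain ⟨⟨a, b⟩, hu, rfl⟩ := Finset.mem_image.1 hA
      obtain ⟨u, hu', rfl⟩ := Finset.mem_image.1 hA'
      have h := hproper _ hu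
      obtain ⟨i, j, hij, h'⟩ := hsigned u hu'
      simp only at h ⊢
      have hrel : TubeCompatible n (c.arc a b) (c.signedArc m u) := by
        rw [hij, c.tubeCompatible_arc h.1 (by omega) (by omega) h'.1 (by omega) (by omega)]
        omega
      exact ⟨hrel, hrel.symm⟩

end CycleCoord

/-- Tubings are sorted by their largest tube containing the vertex `x` or its antipode `y`. If
there is none, the tubes lie in the two paths that remain when `x` and `y` are removed. -/
lemma cliqueSum_tubes {R : Type*} [CommSemiring R] (s : R) {n : ℕ} (hn : 1 ≤ n) :
    cliqueSum s (tubes n) (TubeCompatible n) = signedPathSum s none none (n - 1) +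
      s * (2 * ∑ m ∈ Finset.Icc 1 n, (m : R) *
        (properPathSum s m * signedPathSum s (some false) (some true) (n - m))) := by
  classical
  obtain ⟨c, hc⟩ : ∃ c, c = CycleCoord.standard n := ⟨_, rfl⟩
  obtain ⟨x, hx⟩ := c.exists_eq 0 (by omega)
  obtain ⟨y, hy⟩ := c.exists_eq n (by omega)
  have hxy : (y : ℤ) = -(x : ℤ) := (c.neg_iff x y).2 (Or.inl (by omega))
  have hdisj : ∀ t, (twistedCycle n).IsTube t → x ∈ t → y ∉ t := fun t ht hxt hyt =>
    c.mem_faces_iff.1 ht.1 x hxt y hyt (by omega)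
  obtain ⟨g, hg⟩ : ∃ g : ℕ → R, g = fun m =>
    properPathSum s m * signedPathSum s (some false) (some true) (n - m) := ⟨_, rfl⟩
  have hlink : ∀ w ∈ (tubes n).filter (fun t => x ∈ t ∨ y ∈ t),
      ∃ U : Finset (Finset (PlusMinus n)), (∀ u, u ∈ U ↔ u ∈ tubes n ∧ u ≠ w ∧
        TubeCompatible n u w ∧ ¬((x ∈ u ∨ y ∈ u) ∧ w.card < u.card)) ∧
      cliqueSum s U (TubeCompatible n) = g w.card := by
    intro w hw
    rw [Finset.mem_filter, mem_tubes] at hw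
    obtain ⟨d, m, hm, hmn, rfl⟩ := CycleCoord.exists_eq_initial_arc hw.1
    have hcard : (d.arc 0 m).card = m := d.card_arc (by omega)
    rw [hcard, hg]
    exact d.cliqueSum_link s hm hmn hxy hw.2
  choose! U hU hUsum using hlink
  have hsum : ∑ w ∈ (tubes n).filter (fun t => x ∈ t ∨ y ∈ t), g w.card =
      2 * ∑ m ∈ Finset.Icc 1 n, (m : R) * g m := by
    have hlt : n < 2 * n := by omega
    have hrx : (c.rebase n hlt).toFun x = n := by
      simp only [CycleCoord.rebase]
      split_ifs <;> omega
    rw [Finset.filter_or, Finset.sum_union, (c.rebase n hlt).sum_tubes_through g hrx,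
      c.sum_tubes_through g hy, two_mul]
    · simp only [nsmul_eq_mul]
    · rw [Finset.disjoint_left]
      intro t ht ht'
      rw [Finset.mem_filter, mem_tubes] at ht ht'
      exact hdisj t ht.1 ht.2 ht'.2
  rw [cliqueSum_eq_add_sum s (fun t => x ∈ t ∨ y ∈ t) Finset.card
    ((signedIntervals (n - 1) none none).image (c.signedArc 1))
    ((tubes n).filter (fun t => x ∈ t ∨ y ∈ t)) U, c.cliqueSum_image_signedArc s le_rfl hn,
    Finset.sum_congr rfl hUsum, hsum, hg]
  · exact fun _ _ _ _ h => h.symm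
  · intro t ht u hu hpt hpu hne hrel hcard
    rw [mem_tubes] at ht hu
    have hface := c.mem_faces_iff.1 hrel.2
    -- Otherwise `t` would contain one of `x`, `y` and `u` the other one.
    have hmeet : ∃ a ∈ t, ∃ b ∈ u, a = b ∨ (twistedCycle n).graph.Adj a b := by
      rcases hpt with hxt | hyt <;> rcases hpu with hxu | hyu
      · exact ⟨x, hxt, x, hxu, Or.inl rfl⟩
      · exact absurd (by omega) (hface x (Finset.mem_union_left _ hxt) y
          (Finset.mem_union_right _ hyu))
      · exact absurd (by omega) (hface x (Finset.mem_union_right _ hxu) y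
          (Finset.mem_union_left _ hyt))
      · exact ⟨y, hyt, y, hyu, Or.inl rfl⟩
    rcases hrel.1.nested hmeet with h | h
    · exact hne (Finset.eq_of_subset_of_card_le h hcard.ge)
    · exact hne (Finset.eq_of_subset_of_card_le h hcard.le).symm
  · intro A
    rw [Finset.mem_image, mem_tubes]
    constructor
    · rintro ⟨⟨e, a, b⟩, hu, rfl⟩
      have h := (mem_signedIntervals.1 hu).1
      simp only at h
      cases e <;>
      · simp only [CycleCoord.signedArc, if_true, Bool.false_eq_true, if_false,
          CycleCoord.mem_arc]
        exact ⟨c.isTube_arc (by omega) (by omega) (by omega), by omega⟩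
    · rintro ⟨hA, hnot⟩
      obtain ⟨i, j, hij, hj, hjn, rfl⟩ := c.exists_eq_arc hA (by
        intro p hp _ _ hp0 _
        rw [c.injective (hp0.trans hx.symm)] at hp
        exact hnot (Or.inl hp))
      rw [CycleCoord.mem_arc, CycleCoord.mem_arc] at hnot
      by_cases hjn' : j ≤ n
      · refine ⟨(false, i - 1, j - 1), mem_signedIntervals.2 ⟨by simp only; omega, by simp, by simp⟩,
          ?_⟩
        simp only [CycleCoord.signedArc, Bool.false_eq_true, if_false]
        congr 1 <;> omega
      · refine ⟨(true, i - 1 - n, j - 1 - n),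
          mem_signedIntervals.2 ⟨by simp only; omega, by simp, by simp⟩, ?_⟩
        simp only [CycleCoord.signedArc, if_true]
        congr 1 <;> omega
  · intro t
    rw [Finset.mem_filter]
  · exact hU

/-! ### The face numbers of the complex of tubings -/

lemma isTubing_iff {n : ℕ} {T : Finset {t : Finset (PlusMinus n) // (twistedCycle n).IsTube t}} :
    (twistedCycle n).IsTubing T ↔
      IsRelClique (TubeCompatible n) (T.map (Function.Embedding.subtype _)) := by
  constructor
  · intro hT t' ht' u' hu' _
    obtain ⟨t, ht, rfl⟩ := Finset.mem_map.1 (Finset.mem_coe.1 ht')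
    obtain ⟨u, hu, rfl⟩ := Finset.mem_map.1 (Finset.mem_coe.1 hu')
    exact ⟨hT.1 t ht u hu, (hypercubeComplex n).down_closed hT.2 (Finset.union_subset
      (Finset.subset_biUnion_of_mem Subtype.val ht)
      (Finset.subset_biUnion_of_mem Subtype.val hu))⟩
  · intro hT
    have hrel : ∀ t ∈ T, ∀ u ∈ T, t ≠ u → TubeCompatible n t.1 u.1 := fun t ht u hu hne =>
      hT (Finset.mem_coe.2 (Finset.mem_map_of_mem _ ht))
        (Finset.mem_coe.2 (Finset.mem_map_of_mem _ hu)) (fun h => hne (Subtype.ext h))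
    refine ⟨fun t ht u hu => ?_, ?_⟩
    · by_cases hne : t = u
      · exact Or.inl (hne ▸ Finset.Subset.refl _)
      · exact (hrel t ht u hu hne).1
    · intro x hx y hy
      obtain ⟨t, ht, hxt⟩ := Finset.mem_biUnion.1 hx
      obtain ⟨u, hu, hyu⟩ := Finset.mem_biUnion.1 hy
      by_cases hne : t = u
      · subst hne
        exact t.2.1 x hxt y hyu
      · exact (hrel t ht u hu hne).2 x (Finset.mem_union_left _ hxt) y
          (Finset.mem_union_right _ hyu)

lemma coeff_cliqueSum {α : Type*} (V : Finset α) (r : α → α → Prop) (k : ℕ) :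
    (cliqueSum (Polynomial.X : Polynomial ℚ) V r).coeff k =
      ({T : Finset α | (T ⊆ V ∧ IsRelClique r T) ∧ T.card = k}.ncard : ℚ) := by
  classical
  rw [cliqueSum, Polynomial.finsetSum_coeff]
  simp only [Polynomial.coeff_X_pow]
  rw [Finset.sum_boole, ← Set.ncard_coe_finset]
  congr 2
  ext T
  simp [eq_comm]

/-- The generating function of the tubings of the twisted cycle by their number of tubes. -/
def tubingPolynomial (n : ℕ) : Polynomial ℚ :=
  cliqueSum Polynomial.X (tubes n) (TubeCompatible n)

lemma fVector_tubingComplex (n k : ℕ) :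
    ((twistedCycle n).tubingComplex.fVector k : ℚ) = (tubingPolynomial n).coeff k := by
  classical
  rw [tubingPolynomial, coeff_cliqueSum, FaceComplex.fVector]
  congr 1
  rw [← Set.ncard_image_of_injective _ (Finset.map_injective (Function.Embedding.subtype _))]
  congr 1
  ext T
  simp only [Set.mem_image, Set.mem_ofPred_eq]
  constructor
  · rintro ⟨A, ⟨hA, hcard⟩, rfl⟩
    refine ⟨⟨fun t ht => ?_, isTubing_iff.1 hA⟩, by rw [Finset.card_map, hcard]⟩
    obtain ⟨t, -, rfl⟩ := Finset.mem_map.1 ht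
    exact mem_tubes.2 t.2
  · rintro ⟨⟨hT, hrel⟩, hcard⟩
    have hmap : (T.subtype fun t => (twistedCycle n).IsTube t).map
        (Function.Embedding.subtype _) = T :=
      Finset.subtype_map_of_mem fun t ht => mem_tubes.1 (hT ht)
    refine ⟨T.subtype fun t => (twistedCycle n).IsTube t, ⟨?_, ?_⟩, hmap⟩
    · refine isTubing_iff.2 ?_
      rw [hmap]
      exact hrel
    · rw [← hcard, ← Finset.card_map (Function.Embedding.subtype _), hmap]

lemma tubingPolynomial_zero : tubingPolynomial 0 = 1 := by
  have : tubes 0 = ∅ := by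
    ext t
    simp only [mem_tubes, Finset.notMem_empty, iff_false]
    intro ht
    obtain ⟨⟨x, h0, h1⟩, -⟩ := ht.nonempty
    rw [abs_le] at h1
    omega
  rw [tubingPolynomial, this, cliqueSum_empty]

/-- The generating function of the tubings of all twisted cycles. -/
lemma mk_tubingPolynomial :
    PowerSeries.mk tubingPolynomial *
      ((1 - PowerSeries.X) ^ 2 - 4 * PowerSeries.C Polynomial.X * PowerSeries.X) =
      1 - PowerSeries.X - 2 * PowerSeries.C Polynomial.X * PowerSeries.X := by
  rw [← rational_of_tubeSeries]
  congr 1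
  ext1 n
  rcases n with _ | N
  · simp [tubingPolynomial_zero, mul_assoc]
  · have hassoc : 2 * PowerSeries.X *
        PowerSeries.derivative (Polynomial ℚ) (tubeSeries Polynomial.X) *
          signedPathSeries Polynomial.X (some false) (some true) =
        PowerSeries.X * (PowerSeries.C 2 *
          (PowerSeries.derivative (Polynomial ℚ) (tubeSeries Polynomial.X) *
            signedPathSeries Polynomial.X (some false) (some true))) := by
      rw [map_ofNat]
      ring
    have hsum : PowerSeries.coeff N (PowerSeries.derivative (Polynomial ℚ)
        (tubeSeries Polynomial.X) * signedPathSeries Polynomial.X (some false) (some true)) =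
        Polynomial.X * ∑ m ∈ Finset.Icc 1 (N + 1), (m : Polynomial ℚ) *
          (properPathSum Polynomial.X m *
            signedPathSum Polynomial.X (some false) (some true) (N + 1 - m)) := by
      rw [PowerSeries.coeff_mul, Finset.Nat.sum_antidiagonal_eq_sum_range_succ_mk, Finset.mul_sum,
        ← Finset.Ico_add_one_right_eq_Icc, Finset.sum_Ico_eq_sum_range]
      refine Finset.sum_congr rfl fun i _ => ?_
      simp only [PowerSeries.coeff_derivative, tubeSeries, signedPathSeries, PowerSeries.coeff_mk]
      rw [if_neg i.succ_ne_zero, add_comm 1 i, Nat.add_sub_add_right]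
      push_cast
      ring
    rw [hassoc, map_add, map_add, PowerSeries.coeff_succ_X_mul, PowerSeries.coeff_succ_X_mul,
      PowerSeries.coeff_C_mul, hsum, PowerSeries.coeff_one, if_neg N.succ_ne_zero, zero_add,
      PowerSeries.coeff_mk, tubingPolynomial, cliqueSum_tubes _ (Nat.succ_pos N),
      signedPathSeries, PowerSeries.coeff_mk, Nat.succ_sub_one, mul_left_comm]

/-- The Chebyshev recursion: `tubingPolynomial n` is the Chebyshev polynomial `T n` evaluated at
`1 + 2 * X`. -/
lemma tubingPolynomial_add_two (n : ℕ) : tubingPolynomial (n + 2) =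
    (2 + 4 * Polynomial.X) * tubingPolynomial (n + 1) - tubingPolynomial n := by
  have h := congrArg (PowerSeries.coeff (n + 2)) mk_tubingPolynomial
  have hE : PowerSeries.mk tubingPolynomial *
      ((1 - PowerSeries.X) ^ 2 - 4 * PowerSeries.C Polynomial.X * PowerSeries.X) =
      PowerSeries.mk tubingPolynomial -
        PowerSeries.X * (PowerSeries.C (2 + 4 * Polynomial.X) * PowerSeries.mk tubingPolynomial) +
        PowerSeries.X * (PowerSeries.X * PowerSeries.mk tubingPolynomial) := by
    rw [map_add, map_mul, map_ofNat, map_ofNat]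
    ring
  have hE' : (1 : PowerSeries (Polynomial ℚ)) - PowerSeries.X -
      2 * PowerSeries.C Polynomial.X * PowerSeries.X =
      1 - PowerSeries.X * PowerSeries.C (1 + 2 * Polynomial.X) := by
    rw [map_add, map_one, map_mul, map_ofNat]
    ring
  have hn : n + 1 ≠ 0 := n.succ_ne_zero
  rw [hE, hE', map_add, map_sub, map_sub, PowerSeries.coeff_succ_X_mul,
    PowerSeries.coeff_succ_X_mul, PowerSeries.coeff_succ_X_mul, PowerSeries.coeff_succ_X_mul,
    PowerSeries.coeff_C_mul, PowerSeries.coeff_mk, PowerSeries.coeff_mk, PowerSeries.coeff_mk,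
    PowerSeries.coeff_one, PowerSeries.coeff_C, if_neg (by omega), if_neg (by omega)] at h
  linear_combination h

lemma tubingPolynomial_one : tubingPolynomial 1 = 1 + 2 * Polynomial.X := by
  have hlink := cliqueSum_tubes (Polynomial.X : Polynomial ℚ) (le_refl 1)
  rw [Finset.Icc_self, Finset.sum_singleton, Nat.sub_self, signedPathSum_zero, signedPathSum_zero,
    properPathSum_succ, pathSum_zero] at hlink
  rw [tubingPolynomial, hlink]
  simp [mul_comm]

/-- The number of tubings of the twisted cycle on `2 * n` vertices that consist of `k` tubes. -/
def tubingCount (n k : ℕ) : ℚ := (tubingPolynomial n).coeff k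

lemma tubingCount_zero (k : ℕ) : tubingCount 0 k = if k = 0 then 1 else 0 := by
  rw [tubingCount, tubingPolynomial_zero, Polynomial.coeff_one]

lemma tubingCount_one (k : ℕ) :
    tubingCount 1 k = if k = 0 then 1 else if k = 1 then 2 else 0 := by
  rw [tubingCount, tubingPolynomial_one, Polynomial.coeff_add, Polynomial.coeff_one]
  have : (2 * Polynomial.X : Polynomial ℚ) = Polynomial.C 2 * Polynomial.X := by
    rw [map_ofNat]
  rw [this, Polynomial.coeff_C_mul, Polynomial.coeff_X]
  rcases k with _ | _ | k <;> simp

lemma tubingCount_add_two_zero (n : ℕ) :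
    tubingCount (n + 2) 0 = 2 * tubingCount (n + 1) 0 - tubingCount n 0 := by
  rw [tubingCount, tubingPolynomial_add_two]
  simp [tubingCount, Polynomial.mul_coeff_zero]

lemma tubingCount_add_two_succ (n k : ℕ) : tubingCount (n + 2) (k + 1) =
    2 * tubingCount (n + 1) (k + 1) + 4 * tubingCount (n + 1) k - tubingCount n (k + 1) := by
  have : (2 + 4 * Polynomial.X) * tubingPolynomial (n + 1) =
      Polynomial.C 2 * tubingPolynomial (n + 1) +
        Polynomial.C 4 * (Polynomial.X * tubingPolynomial (n + 1)) := by
    rw [map_ofNat, map_ofNat]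
    ring
  rw [tubingCount, tubingPolynomial_add_two, this, Polynomial.coeff_sub, Polynomial.coeff_add,
    Polynomial.coeff_C_mul, Polynomial.coeff_C_mul, Polynomial.coeff_X_mul]
  rfl

lemma tubingCount_eq_zero {n k : ℕ} (h : n < k) : tubingCount n k = 0 := by
  induction n using Nat.twoStepInduction generalizing k with
  | zero => rw [tubingCount_zero, if_neg (by omega)]
  | one => rw [tubingCount_one, if_neg (by omega), if_neg (by omega)]
  | more n ih1 ih2 =>
    obtain ⟨k, rfl⟩ : ∃ j, k = j + 1 := ⟨k - 1, by omega⟩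
    rw [tubingCount_add_two_succ, ih1 (by omega), ih2 (by omega), ih2 (by omega)]
    ring

lemma tubingCount_self (n : ℕ) : tubingCount (n + 1) (n + 1) = 2 * 4 ^ n := by
  induction n with
  | zero => rw [tubingCount_one, if_neg (by omega), if_pos rfl, pow_zero, mul_one]
  | succ n ih =>
    rw [tubingCount_add_two_succ, ih, tubingCount_eq_zero (by omega),
      tubingCount_eq_zero (by omega)]
    ring

/-! ### Bivariate power series -/

/-- The bivariate power series with rational coefficients `f n k` at `X₀ ^ k * X₁ ^ n`. -/
def rationalSeries (f : ℕ → ℕ → ℚ) : MvPowerSeries (Fin 2) ℚ :=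
  fun e => f (e 1) (e 0)

lemma coeff_rationalSeries (f : ℕ → ℕ → ℚ) (e : Fin 2 →₀ ℕ) :
    MvPowerSeries.coeff e (rationalSeries f) = f (e 1) (e 0) := rfl

lemma X_zero_mul_rationalSeries (f : ℕ → ℕ → ℚ) : MvPowerSeries.X 0 * rationalSeries f =
    rationalSeries fun n k => if k = 0 then 0 else f n (k - 1) := by
  ext e
  rw [MvPowerSeries.X, MvPowerSeries.coeff_monomial_mul, coeff_rationalSeries,
    coeff_rationalSeries, one_mul]
  rcases Nat.eq_zero_or_pos (e 0) with h | h
  · rw [if_neg (by rw [Finsupp.single_le_iff]; omega), if_pos h]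
  · rw [if_pos (by rw [Finsupp.single_le_iff]; omega), if_neg (by omega)]
    simp

lemma X_one_mul_rationalSeries (f : ℕ → ℕ → ℚ) : MvPowerSeries.X 1 * rationalSeries f =
    rationalSeries fun n k => if n = 0 then 0 else f (n - 1) k := by
  ext e
  rw [MvPowerSeries.X, MvPowerSeries.coeff_monomial_mul, coeff_rationalSeries,
    coeff_rationalSeries, one_mul]
  rcases Nat.eq_zero_or_pos (e 1) with h | h
  · rw [if_neg (by rw [Finsupp.single_le_iff]; omega), if_pos h]
  · rw [if_pos (by rw [Finsupp.single_le_iff]; omega), if_neg (by omega)]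
    simp

lemma one_eq_rationalSeries : (1 : MvPowerSeries (Fin 2) ℚ) =
    rationalSeries fun n k => if n = 0 ∧ k = 0 then 1 else 0 := by
  classical
  ext e
  rw [MvPowerSeries.coeff_one, coeff_rationalSeries]
  congr 1
  rw [eq_iff_iff, Finsupp.ext_iff, Fin.forall_fin_two]
  simp [and_comm]

lemma coeff_ofNat_mul (m : ℕ) [m.AtLeastTwo] (F : MvPowerSeries (Fin 2) ℚ) (e : Fin 2 →₀ ℕ) :
    MvPowerSeries.coeff e (ofNat(m) * F) = ofNat(m) * MvPowerSeries.coeff e F := by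
  rw [← map_ofNat (MvPowerSeries.C (σ := Fin 2) (R := ℚ)) m, MvPowerSeries.coeff_C_mul]

/-- The power series of the numbers of tubings. -/
lemma rationalSeries_tubingCount_mul : rationalSeries tubingCount *
    ((1 - MvPowerSeries.X 1) ^ 2 - 4 * MvPowerSeries.X 0 * MvPowerSeries.X 1) =
    (1 - MvPowerSeries.X 1) - 2 * MvPowerSeries.X 0 * MvPowerSeries.X 1 := by
  have hl : ∀ F : MvPowerSeries (Fin 2) ℚ,
      F * ((1 - MvPowerSeries.X 1) ^ 2 - 4 * MvPowerSeries.X 0 * MvPowerSeries.X 1) =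
      F - 2 * (MvPowerSeries.X 1 * F) + MvPowerSeries.X 1 * (MvPowerSeries.X 1 * F) -
        4 * (MvPowerSeries.X 0 * (MvPowerSeries.X 1 * F)) := fun F => by ring
  have hr : (1 - MvPowerSeries.X 1) - 2 * MvPowerSeries.X 0 * MvPowerSeries.X 1 =
      (1 : MvPowerSeries (Fin 2) ℚ) - MvPowerSeries.X 1 * 1 -
        2 * (MvPowerSeries.X 0 * (MvPowerSeries.X 1 * 1)) := by ring
  rw [hl, hr, one_eq_rationalSeries]
  simp only [X_zero_mul_rationalSeries, X_one_mul_rationalSeries]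
  ext e
  simp only [map_add, map_sub, coeff_ofNat_mul, coeff_rationalSeries]
  generalize e 0 = k
  generalize e 1 = n
  rcases n with _ | _ | n
  · simp [tubingCount_zero]
  · rcases k with _ | _ | k
    · simp [tubingCount_zero, tubingCount_one]
      norm_num
    · simp [tubingCount_zero, tubingCount_one]
      norm_num
    · simp [tubingCount_zero, tubingCount_one]
  · rcases k with _ | k
    · simp [tubingCount_add_two_zero]
    · simp [tubingCount_add_two_succ]
      ring

/-- The power series of the numbers of tubings, in terms of the codimension `n - k`. -/
lemma rationalSeries_tubingCount_sub_mul :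
    rationalSeries (fun n k => if k ≤ n then tubingCount n (n - k) else 0) *
    ((1 - MvPowerSeries.X 0 * MvPowerSeries.X 1) ^ 2 - 4 * MvPowerSeries.X 1) =
    (1 - MvPowerSeries.X 0 * MvPowerSeries.X 1) - 2 * MvPowerSeries.X 1 := by
  have hl : ∀ F : MvPowerSeries (Fin 2) ℚ,
      F * ((1 - MvPowerSeries.X 0 * MvPowerSeries.X 1) ^ 2 - 4 * MvPowerSeries.X 1) =
      F - 2 * (MvPowerSeries.X 0 * (MvPowerSeries.X 1 * F)) +
        MvPowerSeries.X 0 * (MvPowerSeries.X 0 * (MvPowerSeries.X 1 * (MvPowerSeries.X 1 * F))) -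
        4 * (MvPowerSeries.X 1 * F) := fun F => by ring
  have hr : (1 - MvPowerSeries.X 0 * MvPowerSeries.X 1) - 2 * MvPowerSeries.X 1 =
      (1 : MvPowerSeries (Fin 2) ℚ) - MvPowerSeries.X 0 * (MvPowerSeries.X 1 * 1) -
        2 * (MvPowerSeries.X 1 * 1) := by ring
  rw [hl, hr, one_eq_rationalSeries]
  simp only [X_zero_mul_rationalSeries, X_one_mul_rationalSeries]
  ext e
  simp only [map_add, map_sub, coeff_ofNat_mul, coeff_rationalSeries]
  generalize e 0 = k
  generalize e 1 = n
  rcases n with _ | _ | n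
  · rcases k with _ | k <;> simp [tubingCount_zero]
  · rcases k with _ | _ | k
    · simp [tubingCount_zero, tubingCount_one]
      norm_num
    · simp [tubingCount_zero, tubingCount_one]
      norm_num
    · simp
  · rcases k with _ | _ | k
    · have h := tubingCount_add_two_succ n (n + 1)
      rw [tubingCount_eq_zero (by omega : n + 1 < n + 1 + 1),
        tubingCount_eq_zero (by omega : n < n + 1 + 1)] at h
      simp [h]
    · have h := tubingCount_add_two_succ n n
      rw [tubingCount_eq_zero (by omega : n < n + 1)] at h
      simp [h]
    · rcases lt_trichotomy k n with hk | rfl | hk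
      · obtain ⟨j, rfl⟩ : ∃ j, n = k + 1 + j := ⟨n - k - 1, by omega⟩
        have h := tubingCount_add_two_succ (k + 1 + j) j
        have h1 : k + 1 + j + 2 - (k + 2) = j + 1 := by omega
        have h2 : k + 1 + j + 1 - (k + 1) = j + 1 := by omega
        have h3 : k + 1 + j - k = j + 1 := by omega
        have h4 : k + 1 + j + 1 - (k + 2) = j := by omega
        have h5 : k ≤ k + 1 + j := by omega
        have h6 : k + 1 ≤ k + 1 + j := by omega
        simp [h1, h2, h3, h4, h5, h6, h]
        ring
      · simp [tubingCount_add_two_zero]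
      · have h1 : ¬k ≤ n := by omega
        have h2 : ¬k + 1 ≤ n := by omega
        simp [h1, h2]

lemma twistedCycle_isMaximalTubing_iff (n : ℕ) (T : Finset {t : Finset (PlusMinus n) // (twistedCycle n).IsTube t}) :
    (twistedCycle n).IsMaximalTubing T ↔ (twistedCycle n).IsTubing T ∧ T.card = n := by
  classical
  have hcard : ∀ A : Finset {t : Finset (PlusMinus n) // (twistedCycle n).IsTube t},
      (twistedCycle n).IsMaximalTubing A → A.card = n := by
    intro A hA
    rw [hA.card_eq]
    have hface := hA.1.2
    have hins := fun i => hA.mem_biUnion (i := i)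
    generalize A.biUnion Subtype.val = U at hface hins
    have himage : U.image (fun x : PlusMinus n => (x : ℤ).natAbs) = Finset.Icc 1 n := by
      ext k
      rw [Finset.mem_image, Finset.mem_Icc]
      constructor
      · rintro ⟨⟨x, h0, h1⟩, -, rfl⟩
        rw [abs_le] at h1
        simp only
        omega
      · intro hk
        by_contra! hno
        let x : PlusMinus n := ⟨k, by omega, abs_le.2 (by omega)⟩
        refine hno x (hins x ?_) (by simp [x])
        intro a ha b hb hab
        have key : ∀ c ∈ U, (c : ℤ) ≠ k ∧ (c : ℤ) ≠ -k := fun c hc => by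
          have := hno c hc
          omega
        have hx : (x : ℤ) = k := rfl
        rcases Finset.mem_insert.1 ha with rfl | ha <;> rcases Finset.mem_insert.1 hb with rfl | hb
        · omega
        · have := key b hb
          omega
        · have := key a ha
          omega
        · exact hface a ha b hb hab
    have hinj : Set.InjOn (fun x : PlusMinus n => (x : ℤ).natAbs) U := by
      intro x hx y hy hxy
      have := hface x hx y hy
      simp only at hxy
      exact Subtype.ext (by omega)
    rw [← Finset.card_image_of_injOn hinj, himage, Nat.card_Icc, Nat.add_sub_cancel]
  constructor
  · exact fun h => ⟨h.1, hcard T h⟩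
  · rintro ⟨hT, hTn⟩
    obtain ⟨A, hTA, hA⟩ := Finite.exists_le_maximal hT
    have := Finset.eq_of_subset_of_card_le hTA (by rw [hTn, hcard A hA])
    exact this ▸ hA

end

theorem mainTheorem3 :
    (∀ P : (n : ℕ) → SimplePolyhedron n,
      (∀ n : ℕ, IsGraphAssociahedron (P n) (twistedCycle n)) →
        polyhedraFPolynomial P =
          ((1 - MvPowerSeries.X 0 * MvPowerSeries.X 1) - 2 * MvPowerSeries.X 1) *
            ((1 - MvPowerSeries.X 0 * MvPowerSeries.X 1) ^ 2 - 4 * MvPowerSeries.X 1)⁻¹) ∧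
    complexesFPolynomial (fun n => (twistedCycle n).tubingComplex) =
      ((1 - MvPowerSeries.X 1) - 2 * MvPowerSeries.X 0 * MvPowerSeries.X 1) *
        ((1 - MvPowerSeries.X 1) ^ 2 - 4 * MvPowerSeries.X 0 * MvPowerSeries.X 1)⁻¹ ∧
    (∀ n : ℕ, 1 ≤ n →
      {T | (twistedCycle n).IsMaximalTubing T}.ncard = 2 ^ (2 * n - 1)) := by
  refine ⟨fun P hP => ?_, ?_, fun n hn => ?_⟩
  · rw [MvPowerSeries.eq_mul_inv_iff_mul_eq (by simp), ← rationalSeries_tubingCount_sub_mul]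
    congr 1
    ext e
    rw [coeff_rationalSeries]
    change ((P (e 1)).fVector (e 0) : ℚ) = _
    split_ifs with h
    · rw [(P (e 1)).fVector_eq_dualComplex_fVector h, (hP (e 1)).fVector_eq, fVector_tubingComplex,
        tubingCount]
    · rw [(P (e 1)).fVector_eq_zero (by omega), Nat.cast_zero]
  · rw [MvPowerSeries.eq_mul_inv_iff_mul_eq (by simp), ← rationalSeries_tubingCount_mul]
    congr 1
    ext e
    exact fVector_tubingComplex (e 1) (e 0)
  · obtain ⟨m, rfl⟩ : ∃ m, n = m + 1 := ⟨n - 1, by omega⟩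
    have hset : {T | (twistedCycle (m + 1)).IsMaximalTubing T} =
        {T | T ∈ (twistedCycle (m + 1)).tubingComplex.faces ∧ T.card = m + 1} := by
      ext T
      exact twistedCycle_isMaximalTubing_iff (m + 1) T
    have hcount := fVector_tubingComplex (m + 1) (m + 1)
    rw [FaceComplex.fVector, ← hset, ← tubingCount, tubingCount_self] at hcount
    have hpow : (2 : ℚ) * 4 ^ m = ((2 ^ (2 * (m + 1) - 1) : ℕ) : ℚ) := by
      rw [show 2 * (m + 1) - 1 = 2 * m + 1 by omega, pow_succ, pow_mul]
      push_cast
      ring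
    rw [hpow] at hcount
    exact_mod_cast hcount
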